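/- **Notation.** For $\rho\in 2^{-\mathbb N}$, $\mathbb N=\{0,1,2,\dots\}$, a dyadic $\rho$-cube is a set $[i\rho,(i+1)\rho)\times[j\rho,(j+1)\rho)\subset\mathbb R^2$, $i,j\in\mathbb Z$. A dyadic $\rho$-tube is a set $T=\bigcup_{(c,d)\in p}\{(x,y)\in\mathbb R^2: y=cx+d\}$, where $p$ is a dyadic $\rho$-cube meeting $[-1,1]\times\mathbb R$. For $\kappa>0$, $\kappa T$ denotes the closed $\kappa\rho$-neighbourhood of the $\rho$-tube $T$. If $\delta\le w$ are dyadic scales and $T$ is a dyadic $\delta$-tube, $T^w$ is the dyadic $w$-tube containing $T$. For a finite multiset $\mathcal P$ of dyadic $\delta$-cubes, $|\mathcal P|$ is its cardinality with multiplicity, $|\mathcal P\cap A|$ is the number of cubes of $\mathcal P$ contained in the set $A$, with multiplicity, and $\mathcal D_w(\mathcal P)$ is the set of dyadic $w$-cubes that meet some cube of $\mathcal P$. Further, $|6(T^w)\cap\mathcal D_w(\mathcal P)|$ is the number of $Q\in\mathcal D_w(\mathcal P)$ contained in $6(T^w)$, and $N_{w,b}(T)$ is the number of $Q\in\mathcal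 D_w(\mathcal P)$ with $|4T\cap Q\cap\mathcal P|\ge b$. **Lemma.** Let $\varepsilon=1/m$ with $m\ge1$ an integer, and let $K\ge1$. There is a constant $C=C(\varepsilon,K)>0$ such that the following holds. Let $\delta,\Delta$ be dyadic scales in $2^{-\mathbb N}$ with $\delta<\Delta/32$ and $\Delta^{\varepsilon}\in2^{-\mathbb N}$. Let $\mathcal P$ be a finite multiset of dyadic $\delta$-cubes contained in $[0,1)^2$ such that * for every $1\le k\le m$, the cubes of $\mathcal D_{\Delta^{k\varepsilon}}(\mathcal P)$ contain about the same number of cubes of $\mathcal P$: $|\mathcal P\cap Q|\le K\,|\mathcal P\cap Q'|$ for all $Q,Q'\in\mathcal D_{\Delta^{k\varepsilon}}(\mathcal P)$; * $\operatorname{dist}(Q,Q')\ge\Delta$ for all distinct $Q,Q'\in\mathcal D_\Delta(\mathcal P)$. Let $a\ge2$ be real and $b\in\mathbb N$ with $ab>\delta^{1-2\varepsilon}|\mathcal P|$, and let $\mathcal T_{a,b}$ be a set of distinct dyadic $\delta$-tubes $T$ satisfying 1. $|6(T^w)\cap\mathcal D_w(\mathcal P)|\le\Delta^{-\varepsilon}\,w\,|\mathcal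 D_w(\mathcal P)|$ for all $w\in\{\Delta^{\varepsilon},\Delta^{2\varepsilon},\dots,\Delta\}$; 2. $N_{\Delta,b}(T)\ge a$. Then $\mathcal T_{a,b}$ is finite and $$|\mathcal T_{a,b}|\le C\,\frac{|\mathcal P|^2}{a^3b^2}\,\delta^{-5\varepsilon}.$$ -/

import Mathlib

namespace RichTubes

/-- The Euclidean plane. -/
abbrev Plane := EuclideanSpace ℝ (Fin 2)

/-- The dyadic scale `2⁻ⁿ`. -/
noncomputable def scale (n : ℕ) : ℝ := ((2 : ℝ) ^ n)⁻¹

/-- The half-open dyadic cube of side `δ = 2⁻ⁿ` with index `q = (i, j)`: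
`[i δ, (i+1) δ) × [j δ, (j+1) δ)`. Dyadic cubes of a fixed scale are recorded by their index;
distinct indices give distinct cubes, see `cube_injective`. -/
def cube (n : ℕ) (q : ℤ × ℤ) : Set Plane :=
  {x | q.1 * scale n ≤ x 0 ∧ x 0 < (q.1 + 1) * scale n ∧
       q.2 * scale n ≤ x 1 ∧ x 1 < (q.2 + 1) * scale n}

/-- The unit square `[0,1)²`. -/
def unitSquare : Set Plane := {x | 0 ≤ x 0 ∧ x 0 < 1 ∧ 0 ≤ x 1 ∧ x 1 < 1}

/-- Point-line duality: `(a, b)` is sent to the line `y = a x + b`. -/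
def dualLine (c : Plane) : Set Plane := {z | z 1 = c 0 * z 0 + c 1}

/-- The tube `⋃_{c ∈ p} D(c)`, where `p` is the dyadic `2⁻ⁿ`-cube with index `t`. -/
def tube (n : ℕ) (t : ℤ × ℤ) : Set Plane := ⋃ c ∈ cube n t, dualLine c

/-- The indices of the dyadic `2⁻ⁿ`-tubes: `t` such that the dyadic cube with index `t` meets
`[-1,1] × ℝ`. Distinct indices give distinct tubes, see `tube_injective`. -/
def tubeIndices (n : ℕ) : Set (ℤ × ℤ) := {t | ∃ c ∈ cube n t, -1 ≤ c 0 ∧ c 0 ≤ 1}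

/-- For `r ≤ n`, the index of the dyadic `2⁻ʳ`-cube (resp. `2⁻ʳ`-tube) containing the dyadic
`2⁻ⁿ`-cube (resp. `2⁻ⁿ`-tube) with index `q`, see `cube_subset_iff` and `tube_subset_iff`. -/
def ancestor (n r : ℕ) (q : ℤ × ℤ) : ℤ × ℤ := (q.1 / 2 ^ (n - r), q.2 / 2 ^ (n - r))

/-- `𝒟_w(𝒫)` for `w = 2⁻ʳ` and a multiset `P` of dyadic `2⁻ⁿ`-cubes: the set of (indices of)
dyadic `w`-cubes that meet some cube of `P`. -/
def coverCubes (n r : ℕ) (P : Multiset (ℤ × ℤ)) : Set (ℤ × ℤ) :=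
  {Q | ∃ p ∈ P, (cube n p ∩ cube r Q).Nonempty}

open Classical in
/-- `|𝒫 ∩ A|`: the number of cubes of the multiset `P` of dyadic `2⁻ⁿ`-cubes that are contained
in the set `A`, counted with multiplicity. -/
noncomputable def cubeCount (n : ℕ) (P : Multiset (ℤ × ℤ)) (A : Set Plane) : ℕ :=
  P.countP fun p => cube n p ⊆ A

/-- The thickened tube `κ T`: the closed `κ δ`-neighbourhood of the dyadic `δ`-tube `T`,
`δ = 2⁻ⁿ`. -/
noncomputable def fatTube (κ : ℝ) (n : ℕ) (t : ℤ × ℤ) : Set Plane :=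
  Metric.cthickening (κ * scale n) (tube n t)

/-- `N_{w,b}(T)` with `w = 2⁻ʳ`, for a `2⁻ⁿ`-tube `T`: the number of `Q ∈ 𝒟_w(𝒫)` with
`|4T ∩ Q ∩ 𝒫| ≥ b`. -/
noncomputable def richCount (n r b : ℕ) (P : Multiset (ℤ × ℤ)) (t : ℤ × ℤ) : ℕ :=
  {Q ∈ coverCubes n r P | b ≤ cubeCount n P (fatTube 4 n t ∩ cube r Q)}.ncard

/-- `|6(T^w) ∩ 𝒟_w(𝒫)|` with `w = 2⁻ʳ`, for a `2⁻ⁿ`-tube `T`: the number of `Q ∈ 𝒟_w(𝒫)`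
contained in `6(T^w)`, where `T^w` is the dyadic `w`-tube containing `T`. -/
noncomputable def thickCount (n r : ℕ) (P : Multiset (ℤ × ℤ)) (t : ℤ × ℤ) : ℕ :=
  {Q ∈ coverCubes n r P | cube r Q ⊆ fatTube 6 r (ancestor n r t)}.ncard

theorem scale_pos (n : ℕ) : 0 < scale n := by unfold scale; positivity

theorem scale_eq_mul {n r : ℕ} (h : r ≤ n) :
    scale r = (((2 : ℤ) ^ (n - r) : ℤ) : ℝ) * scale n := by
  unfold scale
  have h2 : (2 : ℝ) ^ n = 2 ^ (n - r) * 2 ^ r := by rw [← pow_add, Nat.sub_add_cancel h]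
  rw [h2]
  push_cast
  field_simp

theorem corner_mem_cube (n : ℕ) (q : ℤ × ℤ) :
    (!₂[(q.1 : ℝ) * scale n, (q.2 : ℝ) * scale n] : Plane) ∈ cube n q := by
  have := scale_pos n
  refine ⟨by simp, ?_, by simp, ?_⟩ <;> simp <;> nlinarith

theorem mem_cube_iff (n : ℕ) (q : ℤ × ℤ) (x : Plane) :
    x ∈ cube n q ↔ ⌊x 0 / scale n⌋ = q.1 ∧ ⌊x 1 / scale n⌋ = q.2 := by
  have := scale_pos n
  simp only [cube, Set.mem_ofPred_eq, Int.floor_eq_iff, le_div_iff₀ this, div_lt_iff₀ this]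
  tauto

theorem cube_subset_cube_ancestor {n r : ℕ} (h : r ≤ n) (q : ℤ × ℤ) :
    cube n q ⊆ cube r (ancestor n r q) := by
  intro x hx
  rw [mem_cube_iff] at hx ⊢
  have hn := (scale_pos n).ne'
  have key : ∀ y : ℝ, ⌊y / scale r⌋ = ⌊y / scale n⌋ / 2 ^ (n - r) := by
    intro y
    have e : y / scale r = y / scale n / ((2 ^ (n - r) : ℕ) : ℝ) := by
      rw [scale_eq_mul h]
      push_cast
      field_simp
    rw [e, Int.floor_div_natCast]
    push_cast
    rfl
  rw [key, key, hx.1, hx.2]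
  exact ⟨rfl, rfl⟩

theorem cube_subset_iff {n r : ℕ} (h : r ≤ n) (q Q : ℤ × ℤ) :
    cube n q ⊆ cube r Q ↔ Q = ancestor n r q := by
  constructor
  · intro hs
    have h1 := (mem_cube_iff _ _ _).1 (hs (corner_mem_cube n q))
    have h2 := (mem_cube_iff _ _ _).1 (cube_subset_cube_ancestor h q (corner_mem_cube n q))
    exact Prod.ext (h1.1.symm.trans h2.1) (h1.2.symm.trans h2.2)
  · rintro rfl
    exact cube_subset_cube_ancestor h q

theorem ancestor_self (n : ℕ) (q : ℤ × ℤ) : ancestor n n q = q := by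
  simp [ancestor]

theorem cube_injective (n : ℕ) : Function.Injective (cube n) := by
  intro q q' h
  have := (cube_subset_iff le_rfl q q').1 h.subset
  rw [ancestor_self] at this
  exact this.symm

theorem tube_mono {n r : ℕ} {q Q : ℤ × ℤ} (h : cube n q ⊆ cube r Q) : tube n q ⊆ tube r Q :=
  Set.biUnion_subset_biUnion_left h

theorem tube_subset_iff {n r : ℕ} (h : r ≤ n) (t T : ℤ × ℤ) :
    tube n t ⊆ tube r T ↔ T = ancestor n r t := by
  constructor
  · intro hs
    rw [← cube_subset_iff h]
    intro c hc
    have hr := scale_pos r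
    -- every point of the line dual to `c` lies on a line dual to a point of the cube `T`
    have key : ∀ x : ℝ, ∃ d ∈ cube r T, c 0 * x + c 1 = d 0 * x + d 1 := by
      intro x
      have hz : (!₂[x, c 0 * x + c 1] : Plane) ∈ tube n t := by
        refine Set.mem_biUnion hc ?_
        simp [dualLine]
      obtain ⟨d, hd, hd'⟩ := Set.mem_iUnion₂.1 (hs hz)
      exact ⟨d, hd, by simpa [dualLine] using hd'⟩
    obtain ⟨d, hd, h0⟩ := key 0
    have hb : d 1 = c 1 := by simpa using h0.symm
    have hcb : T.2 * scale r ≤ c 1 ∧ c 1 < (T.2 + 1) * scale r := hb ▸ ⟨hd.2.2.1, hd.2.2.2⟩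
    -- first the closed inequalities for the slope; the right end point is excluded afterwards,
    -- using a larger slope in the half-open cube `t`
    have closed : ∀ c ∈ cube n t, T.1 * scale r ≤ c 0 ∧ c 0 ≤ (T.1 + 1) * scale r := by
      intro c hc
      have key : ∀ x : ℝ, ∃ d ∈ cube r T, c 0 * x + c 1 = d 0 * x + d 1 := by
        intro x
        have hz : (!₂[x, c 0 * x + c 1] : Plane) ∈ tube n t := by
          refine Set.mem_biUnion hc ?_
          simp [dualLine]
        obtain ⟨d, hd, hd'⟩ := Set.mem_iUnion₂.1 (hs hz)
        exact ⟨d, hd, by simpa [dualLine] using hd'⟩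
      obtain ⟨d, hd, h0⟩ := key 0
      have hb : d 1 = c 1 := by simpa using h0.symm
      have h3 := hd.2.2.1
      have h4 := hd.2.2.2
      rw [hb] at h3 h4
      constructor
      · by_contra! hlt
        set g := T.1 * scale r - c 0 with hg
        have hg0 : 0 < g := by linarith
        obtain ⟨d, hd, hd'⟩ := key (scale r / g)
        have e1 := hd.1
        have e2 := hd.2.2.1
        have hx : 0 < scale r / g := by positivity
        have e3 : g * (scale r / g) = scale r := by field_simp
        nlinarith [mul_le_mul_of_nonneg_right e1 hx.le]
      · by_contra! hlt
        set g := c 0 - (T.1 + 1) * scale r with hg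
        have hg0 : 0 < g := by linarith
        obtain ⟨d, hd, hd'⟩ := key (scale r / g)
        have e1 := hd.2.1
        have e2 := hd.2.2.2
        have hx : 0 < scale r / g := by positivity
        have e3 : g * (scale r / g) = scale r := by field_simp
        nlinarith [mul_le_mul_of_nonneg_right e1.le hx.le]
    refine ⟨(closed c hc).1, ?_, hcb.1, hcb.2⟩
    have hlt := hc.2.1
    set m := (c 0 + (t.1 + 1) * scale n) / 2 with hm
    have hc' : (!₂[m, c 1] : Plane) ∈ cube n t := by
      refine ⟨?_, ?_, ?_, ?_⟩
      · have := hc.1; simp; linarith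
      · simp; linarith
      · simpa using hc.2.2.1
      · simpa using hc.2.2.2
    have := (closed _ hc').2
    simp at this
    linarith
  · rintro rfl
    exact tube_mono (cube_subset_cube_ancestor h t)

theorem tube_injective (n : ℕ) : Function.Injective (tube n) := by
  intro t t' h
  have := (tube_subset_iff le_rfl t t').1 h.subset
  rw [ancestor_self] at this
  exact this.symm

theorem coverCubes_eq {n r : ℕ} (h : r ≤ n) (P : Multiset (ℤ × ℤ)) :
    coverCubes n r P = {Q | ∃ p ∈ P, ancestor n r p = Q} := by
  ext Q
  constructor
  · rintro ⟨p, hp, x, hx, hxQ⟩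
    have h1 := (mem_cube_iff _ _ _).1 (cube_subset_cube_ancestor h p hx)
    have h2 := (mem_cube_iff _ _ _).1 hxQ
    exact ⟨p, hp, Prod.ext (h1.1.symm.trans h2.1) (h1.2.symm.trans h2.2)⟩
  · rintro ⟨p, hp, rfl⟩
    exact ⟨p, hp, _, corner_mem_cube n p, cube_subset_cube_ancestor h p (corner_mem_cube n p)⟩

/-- At the scales that are used, `𝒟_w(𝒫)` is finite, so its `ncard` is its cardinality. -/
theorem coverCubes_finite {n r : ℕ} (h : r ≤ n) (P : Multiset (ℤ × ℤ)) :
    (coverCubes n r P).Finite := by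
  rw [coverCubes_eq h]
  refine ((P.toFinset.image (ancestor n r)).finite_toSet).subset ?_
  rintro Q ⟨p, hp, rfl⟩
  simp only [Finset.coe_image, Set.mem_image, Finset.mem_coe, Multiset.mem_toFinset]
  exact ⟨p, hp, rfl⟩

end RichTubes

open RichTubes

/-!
The proof is an elementary form of the high-low method. A cube is replaced by its lower left
corner, a tube by the line `y = c x + e` dual to the corner of its parameter square, and the
number of points near a line is compared at different widths. Write `δ = 2⁻ⁿ` and `Δ = 2⁻ᴬ`.

*High frequencies.* Let `F(c, e)` be the number of points within vertical distance `u` of the line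
`y = c x + e`, divided by `2 u`, minus the same quantity for a larger width `v`. The integral of
`F²` over heights `e` and slopes `c`, with a Lipschitz cutoff in `c`, is a quadratic form in the
points (`integral_band`). Its kernel is at most about `1 / max (r, u)` for two points at distance
`r ≲ v` (`bandKernel_near`). It decays like `v / r²` for `r ≫ v`, since both normalised bumps have
integral one (`bandKernel_far`); this plays the role of the `L²` estimate for the high-frequency
part, and no Fourier transform is needed. With `v = Δ`, the distances `r ≥ Δ` cause only a
logarithmic loss, because a ball of radius `r` meets `O((r / Δ)²)` of the `Δ`-cubes and by
uniformity none of these holds much more than the average number of points (`card_ball_le`).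

*Pruning.* The contribution of distances below `Δ` is controlled after removing, scale by scale,
the points whose small balls are too crowded (`pruned`, `energy_pruned_le`). While a line is not
much richer at the scale `ρ` than expected, a crowded ball near it uses up many of the points in
its `ρ`-neighbourhood. Crowded balls in different `Δ`-cubes are disjoint by separation, so the
removed points meet few of the `Δ`-cubes of the line (`card_pruned_cells_mul_le`).

*Crossing scale.* By non-concentration a line is not overly rich at the scale `Δ`, whereas by the
hypothesis on `a b` it is overly rich at the scale `δ`. Hence, going down from `Δ`, there is a
first scale `w` at which it becomes so. Beforehand the cells of the line are localised to a slab
of width `d` in which many pairs of points have distance comparable to `d`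
(`exists_localized_pairs`); all this is `exists_crossing`.

*Counting.* For fixed `w` and a fixed slab, `F` is large on a `w`-neighbourhood of each line, so
the integral of `F²` bounds the measure of the union of these neighbourhoods. The number of lines
sharing a neighbourhood is bounded by double counting, since they all draw their pairs of points
from the same, not too rich, `w`-neighbourhood, and a pair at distance `d` lies on `O(1 / d)` of
the lines (`card_lines_le`). The powers of `d` and `w` cancel (`card_family_mul_le`), and summing
over the `O(n)` choices for each of `d` and `w` costs only powers of `n`, which are absorbed into
`δ^(-ε)` (`exists_growth`).
-/

open MeasureTheory

namespace RichTubes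

variable {ι : Type*}

/-! ### Bumps and their correlations -/

/-- The normalised indicator function of `[-u, u]`. -/
noncomputable def bump (u v : ℝ) : ℝ := if |v| ≤ u then (2 * u)⁻¹ else 0

/-- A Lipschitz cutoff for slopes: it is `1` on `[-3, 3]` and vanishes outside `[-4, 4]`. -/
noncomputable def cutoff (c : ℝ) : ℝ := max 0 (min 1 (4 - |c|))

theorem bump_nonneg {u : ℝ} (hu : 0 < u) (v : ℝ) : 0 ≤ bump u v := by
  unfold bump; split_ifs <;> positivity

theorem bump_le {u : ℝ} (hu : 0 < u) (v : ℝ) : bump u v ≤ (2 * u)⁻¹ := by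
  unfold bump; split_ifs
  · exact le_rfl
  · positivity

theorem bump_of_le {u v : ℝ} (h : |v| ≤ u) : bump u v = (2 * u)⁻¹ := if_pos h

theorem bump_of_lt {u v : ℝ} (h : u < |v|) : bump u v = 0 := if_neg h.not_ge

@[fun_prop]
theorem measurable_bump (u : ℝ) : Measurable (bump u) := by
  unfold bump
  exact Measurable.ite (measurableSet_le (by fun_prop) (by fun_prop)) (by fun_prop) (by fun_prop)

theorem bump_eq_indicator (u : ℝ) :
    bump u = (Set.Icc (-u) u).indicator fun _ => (2 * u)⁻¹ := by
  ext v
  simp [bump, Set.indicator, abs_le]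

theorem integrable_bump (u : ℝ) : Integrable (bump u) := by
  rw [bump_eq_indicator, integrable_indicator_iff measurableSet_Icc]
  exact integrableOn_const (by simp)

theorem integral_bump {u : ℝ} (hu : 0 < u) : ∫ v, bump u v = 1 := by
  rw [bump_eq_indicator, integral_indicator_const _ measurableSet_Icc]
  simp only [measureReal_def, Real.volume_Icc, smul_eq_mul]
  rw [ENNReal.toReal_ofReal (by linarith)]
  field_simp
  ring

theorem cutoff_nonneg (c : ℝ) : 0 ≤ cutoff c := le_max_left _ _

theorem cutoff_le_one (c : ℝ) : cutoff c ≤ 1 := by simp [cutoff]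

theorem cutoff_of_le {c : ℝ} (h : |c| ≤ 3) : cutoff c = 1 := by
  unfold cutoff
  rw [min_eq_left (by linarith)]; simp

theorem cutoff_of_lt {c : ℝ} (h : 4 < |c|) : cutoff c = 0 := by
  unfold cutoff
  exact max_eq_left ((min_le_right _ _).trans (by linarith))

theorem abs_cutoff_sub_le (c d : ℝ) : |cutoff c - cutoff d| ≤ |c - d| := by
  unfold cutoff
  refine (abs_max_sub_max_le_max _ _ _ _).trans (max_le (by simp) ?_)
  refine (abs_min_sub_min_le_max _ _ _ _).trans (max_le (by simp) ?_)
  rw [show 4 - |c| - (4 - |d|) = |d| - |c| by ring, abs_sub_comm c d]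
  exact abs_abs_sub_abs_le_abs_sub d c

@[fun_prop]
theorem measurable_cutoff : Measurable cutoff := by
  unfold cutoff; fun_prop

theorem integrable_of_bounded_support {f : ℝ × ℝ → ℝ} (hf : Measurable f) {C R : ℝ}
    (hC : ∀ z, |f z| ≤ C) (hR : ∀ z, f z ≠ 0 → |z.1| ≤ R ∧ |z.2| ≤ R) : Integrable f := by
  have hs : Function.support f ⊆ Metric.closedBall 0 R := by
    intro z hz
    have := hR z hz
    simp only [Metric.mem_closedBall, dist_zero_right, Prod.norm_def, Real.norm_eq_abs]
    exact max_le this.1 this.2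
  rw [← integrableOn_iff_integrable_of_support_subset hs]
  refine Measure.integrableOn_of_bounded (M := C) ?_ hf.aestronglyMeasurable ?_
  · exact (measure_closedBall_lt_top).ne
  · exact Filter.Eventually.of_forall fun z => hC z

/-- The correlation of two bumps. -/
noncomputable def bumpCorr (a b t : ℝ) : ℝ := ∫ s, bump a s * bump b (s + t)

theorem integrable_bump_mul (a : ℝ) {b : ℝ} (hb : 0 < b) (t : ℝ) :
    Integrable fun s => bump a s * bump b (s + t) := by
  refine (integrable_bump a).mul_bdd (c := (2 * b)⁻¹) ?_ ?_
  · exact ((measurable_bump b).comp (by fun_prop)).aestronglyMeasurable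
  · refine Filter.Eventually.of_forall fun s => ?_
    rw [Real.norm_eq_abs, abs_of_nonneg (bump_nonneg hb _)]
    exact bump_le hb _

theorem bumpCorr_nonneg {a b : ℝ} (ha : 0 < a) (hb : 0 < b) (t : ℝ) : 0 ≤ bumpCorr a b t :=
  integral_nonneg fun _ => mul_nonneg (bump_nonneg ha _) (bump_nonneg hb _)

theorem bumpCorr_le {a b : ℝ} (ha : 0 < a) (hb : 0 < b) (t : ℝ) :
    bumpCorr a b t ≤ (2 * b)⁻¹ := by
  have h : bumpCorr a b t ≤ ∫ s, bump a s * (2 * b)⁻¹ := by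
    refine integral_mono (integrable_bump_mul a hb t) ((integrable_bump a).mul_const _) ?_
    intro s
    exact mul_le_mul_of_nonneg_left (bump_le hb _) (bump_nonneg ha _)
  rwa [integral_mul_const, integral_bump ha, one_mul] at h

theorem bumpCorr_eq_zero {a b t : ℝ} (h : a + b < |t|) : bumpCorr a b t = 0 := by
  unfold bumpCorr
  rw [show (fun s => bump a s * bump b (s + t)) = fun _ => (0 : ℝ) by
    ext s
    by_cases hs : |s| ≤ a
    · have : |t| ≤ |s + t| + |s| := by
        have := abs_sub (s + t) s
        simpa using this
      rw [bump_of_lt (u := b) (by linarith), mul_zero]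
    · rw [bump_of_lt (lt_of_not_ge hs), zero_mul]]
  simp

@[fun_prop]
theorem measurable_bumpCorr (a b : ℝ) : Measurable (bumpCorr a b) := by
  unfold bumpCorr
  refine (StronglyMeasurable.integral_prod_right (f := fun t s => bump a s * bump b (s + t))
    ?_).measurable
  refine Measurable.stronglyMeasurable ?_
  exact ((measurable_bump a).comp measurable_snd).mul
    ((measurable_bump b).comp (measurable_snd.add measurable_fst))

theorem integrable_corr_prod {a b : ℝ} (ha : 0 < a) (hb : 0 < b) :
    Integrable fun z : ℝ × ℝ => bump a z.2 * bump b (z.2 + z.1) := by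
  refine integrable_of_bounded_support (C := (2 * a)⁻¹ * (2 * b)⁻¹) (R := a + a + b) ?_ ?_ ?_
  · exact ((measurable_bump a).comp measurable_snd).mul
      ((measurable_bump b).comp (measurable_snd.add measurable_fst))
  · intro z
    rw [abs_of_nonneg (mul_nonneg (bump_nonneg ha _) (bump_nonneg hb _))]
    exact mul_le_mul (bump_le ha _) (bump_le hb _) (bump_nonneg hb _) (by positivity)
  · intro z hz
    have h1 : |z.2| ≤ a := by
      by_contra h
      exact hz (by rw [bump_of_lt (lt_of_not_ge h), zero_mul])
    have h2 : |z.2 + z.1| ≤ b := by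
      by_contra h
      exact hz (by rw [bump_of_lt (lt_of_not_ge h), mul_zero])
    have h3 : |z.1| ≤ |z.2 + z.1| + |z.2| := by
      have := abs_sub (z.2 + z.1) z.2
      simpa using this
    constructor <;> linarith

theorem integrable_bumpCorr {a b : ℝ} (ha : 0 < a) (hb : 0 < b) : Integrable (bumpCorr a b) :=
  (integrable_corr_prod ha hb).integral_prod_left

theorem integral_bumpCorr {a b : ℝ} (ha : 0 < a) (hb : 0 < b) : ∫ t, bumpCorr a b t = 1 := by
  unfold bumpCorr
  rw [integral_integral_swap (integrable_corr_prod ha hb)]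
  have h : ∀ s, ∫ t, bump a s * bump b (s + t) = bump a s := by
    intro s
    rw [integral_const_mul, integral_add_left_eq_self (bump b) s, integral_bump hb, mul_one]
  simp_rw [h]
  exact integral_bump ha

/-- Substitution along a line: the slope `c` runs over `ℝ`. -/
theorem integral_comp_slope (f : ℝ → ℝ) (X Y : ℝ) :
    ∫ c, f (Y - c * X) = |X|⁻¹ * ∫ t, f t := by
  rw [Measure.integral_comp_mul_right (fun t => f (Y - t)) X, integral_sub_left_eq_self,
    abs_inv, smul_eq_mul]

theorem integrable_comp_slope {f : ℝ → ℝ} (hf : Integrable f) {X : ℝ} (hX : X ≠ 0) (Y : ℝ) :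
    Integrable fun c => f (Y - c * X) :=
  (hf.comp_sub_left Y).comp_mul_right' hX

/-! ### The kernel of the band-limited quadratic form -/

/-- The correlation of two bumps, averaged over the slopes `c`: `X`, `Y` are the coordinates of
the difference of two points. -/
noncomputable def slopeCorr (a b X Y : ℝ) : ℝ := ∫ c, cutoff c * bumpCorr a b (Y - c * X)

theorem integrable_line_prod {a b : ℝ} (ha : 0 < a) (hb : 0 < b) (x y x' y' : ℝ) :
    Integrable fun z : ℝ × ℝ =>
      cutoff z.1 * (bump a (y - z.1 * x - z.2) * bump b (y' - z.1 * x' - z.2)) := by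
  refine integrable_of_bounded_support (C := 1 * ((2 * a)⁻¹ * (2 * b)⁻¹))
    (R := 4 + |y| + 4 * |x| + a) ?_ ?_ ?_
  · fun_prop
  · intro z
    rw [abs_of_nonneg (mul_nonneg (cutoff_nonneg _)
      (mul_nonneg (bump_nonneg ha _) (bump_nonneg hb _)))]
    refine mul_le_mul (cutoff_le_one _) ?_ ?_ zero_le_one
    · exact mul_le_mul (bump_le ha _) (bump_le hb _) (bump_nonneg hb _) (by positivity)
    · exact mul_nonneg (bump_nonneg ha _) (bump_nonneg hb _)
  · intro z hz
    have h1 : |z.1| ≤ 4 := by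
      by_contra h
      exact hz (by rw [cutoff_of_lt (lt_of_not_ge h), zero_mul])
    have h2 : |y - z.1 * x - z.2| ≤ a := by
      by_contra h
      exact hz (by rw [bump_of_lt (lt_of_not_ge h), zero_mul, mul_zero])
    have h3 : |z.1 * x| ≤ 4 * |x| := by
      rw [abs_mul]; exact mul_le_mul_of_nonneg_right h1 (abs_nonneg _)
    have := abs_nonneg y
    have := abs_nonneg x
    refine ⟨by linarith, ?_⟩
    have e1 := abs_le.1 h2
    have e2 := abs_le.1 h3
    have e3 := neg_abs_le y
    have e4 := le_abs_self y
    rw [abs_le]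
    constructor <;> linarith

theorem integral_line_prod {a b : ℝ} (ha : 0 < a) (hb : 0 < b) (x y x' y' : ℝ) :
    ∫ z : ℝ × ℝ, cutoff z.1 * (bump a (y - z.1 * x - z.2) * bump b (y' - z.1 * x' - z.2)) =
      slopeCorr a b (x' - x) (y' - y) := by
  rw [Measure.volume_eq_prod, integral_prod _ (by
    rw [← Measure.volume_eq_prod]; exact integrable_line_prod ha hb x y x' y')]
  unfold slopeCorr bumpCorr
  congr 1
  ext c
  simp only
  rw [integral_const_mul]
  congr 1
  rw [← integral_sub_left_eq_self _ _ (y - c * x)]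
  congr 1
  ext s
  congr 2 <;> ring

theorem integrable_slopeCorr {a b : ℝ} (ha : 0 < a) (hb : 0 < b) (X Y : ℝ) :
    Integrable fun c => cutoff c * bumpCorr a b (Y - c * X) := by
  have hs : Function.support (fun c => cutoff c * bumpCorr a b (Y - c * X)) ⊆ Set.Icc (-4) 4 := by
    intro c hc
    rw [Set.mem_Icc, ← abs_le]
    by_contra h
    exact hc (by simp only; rw [cutoff_of_lt (lt_of_not_ge h), zero_mul])
  rw [← integrableOn_iff_integrable_of_support_subset hs]
  refine Measure.integrableOn_of_bounded (M := 1 * (2 * b)⁻¹) (by simp) ?_ ?_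
  · exact (show Measurable (fun c => cutoff c * bumpCorr a b (Y - c * X)) by
      fun_prop).aestronglyMeasurable
  · refine Filter.Eventually.of_forall fun c => ?_
    rw [Real.norm_eq_abs, abs_of_nonneg (mul_nonneg (cutoff_nonneg _) (bumpCorr_nonneg ha hb _))]
    exact mul_le_mul (cutoff_le_one _) (bumpCorr_le ha hb _) (bumpCorr_nonneg ha hb _) zero_le_one

theorem slopeCorr_nonneg {a b : ℝ} (ha : 0 < a) (hb : 0 < b) (X Y : ℝ) :
    0 ≤ slopeCorr a b X Y :=
  integral_nonneg fun _ => mul_nonneg (cutoff_nonneg _) (bumpCorr_nonneg ha hb _)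

theorem slopeCorr_le_inv {a b : ℝ} (ha : 0 < a) (hb : 0 < b) (X Y : ℝ) :
    slopeCorr a b X Y ≤ 4 / b := by
  have h : slopeCorr a b X Y ≤ ∫ c, (Set.Icc (-4 : ℝ) 4).indicator (fun _ => (2 * b)⁻¹) c := by
    refine integral_mono (integrable_slopeCorr ha hb X Y) ?_ ?_
    · rw [integrable_indicator_iff measurableSet_Icc]
      exact integrableOn_const (by simp)
    · intro c
      simp only [Set.indicator, Set.mem_Icc, ← abs_le]
      split_ifs with hc
      · calc cutoff c * bumpCorr a b (Y - c * X) ≤ 1 * (2 * b)⁻¹ :=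
              mul_le_mul (cutoff_le_one _) (bumpCorr_le ha hb _) (bumpCorr_nonneg ha hb _)
                zero_le_one
          _ = _ := one_mul _
      · rw [cutoff_of_lt (lt_of_not_ge hc), zero_mul]
  refine h.trans (le_of_eq ?_)
  rw [integral_indicator_const _ measurableSet_Icc]
  simp only [measureReal_def, Real.volume_Icc, smul_eq_mul]
  rw [ENNReal.toReal_ofReal (by norm_num)]
  field_simp
  ring

/-- Two points at horizontal distance `|X|` are both close to a line for few slopes only. -/
theorem slopeCorr_self_le {u : ℝ} (hu : 0 < u) {X : ℝ} (hX : X ≠ 0) (Y : ℝ) :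
    slopeCorr u u X Y ≤ 2 / |X| := by
  have h : slopeCorr u u X Y ≤ ∫ c, 2 * bump (2 * u) (Y - c * X) := by
    refine integral_mono (integrable_slopeCorr hu hu X Y)
      ((integrable_comp_slope (integrable_bump _) hX Y).const_mul 2) ?_
    intro c
    simp only
    by_cases hc : |Y - c * X| ≤ 2 * u
    · rw [bump_of_le hc]
      calc cutoff c * bumpCorr u u (Y - c * X) ≤ 1 * (2 * u)⁻¹ :=
              mul_le_mul (cutoff_le_one _) (bumpCorr_le hu hu _) (bumpCorr_nonneg hu hu _)
                zero_le_one
          _ = _ := by field_simp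
    · rw [bumpCorr_eq_zero (by linarith), mul_zero]
      exact mul_nonneg zero_le_two (bump_nonneg (by positivity) _)
  refine h.trans (le_of_eq ?_)
  rw [integral_const_mul, integral_comp_slope, integral_bump (by positivity)]
  field_simp

theorem slopeCorr_eq_zero {a b X Y : ℝ} (h : 4 * |X| + (a + b) < |Y|) :
    slopeCorr a b X Y = 0 := by
  unfold slopeCorr
  rw [show (fun c => cutoff c * bumpCorr a b (Y - c * X)) = fun _ => (0 : ℝ) by
    ext c
    by_cases hc : |c| ≤ 4
    · have h1 : |c * X| ≤ 4 * |X| := by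
        rw [abs_mul]; exact mul_le_mul_of_nonneg_right hc (abs_nonneg _)
      have h2 := abs_sub_abs_le_abs_sub Y (c * X)
      rw [bumpCorr_eq_zero (by linarith), mul_zero]
    · rw [cutoff_of_lt (lt_of_not_ge hc), zero_mul]]
  simp

/-- For `|X|` large, the averaged correlation depends on the widths of the bumps to second order
only, because bumps have integral one and the cutoff is Lipschitz. -/
theorem abs_slopeCorr_sub_le {a b : ℝ} (ha : 0 < a) (hb : 0 < b) {X : ℝ} (hX : X ≠ 0) (Y : ℝ) :
    |slopeCorr a b X Y - cutoff (Y / X) / (|X|)| ≤ (a + b) / |X| ^ 2 := by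
  have hX' : 0 < |X| := abs_pos.2 hX
  have hi := integrable_comp_slope (integrable_bumpCorr ha hb) hX Y
  have e1 : ∫ c, bumpCorr a b (Y - c * X) = |X|⁻¹ := by
    rw [integral_comp_slope, integral_bumpCorr ha hb, mul_one]
  have e2 : cutoff (Y / X) / |X| = ∫ c, cutoff (Y / X) * bumpCorr a b (Y - c * X) := by
    rw [integral_const_mul, e1, div_eq_mul_inv]
  rw [e2, slopeCorr, ← integral_sub (integrable_slopeCorr ha hb X Y) (hi.const_mul _)]
  refine (abs_integral_le_integral_abs).trans ?_
  have e3 : (a + b) / |X| ^ 2 = ∫ c, (a + b) / |X| * bumpCorr a b (Y - c * X) := by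
    rw [integral_const_mul, e1]
    field_simp
  rw [e3]
  refine integral_mono ((integrable_slopeCorr ha hb X Y).sub (hi.const_mul _)).abs
    (hi.const_mul _) ?_
  intro c
  simp only
  rw [← sub_mul, abs_mul, abs_of_nonneg (bumpCorr_nonneg ha hb _)]
  by_cases hc : |Y - c * X| ≤ a + b
  · refine mul_le_mul_of_nonneg_right ((abs_cutoff_sub_le _ _).trans ?_) (bumpCorr_nonneg ha hb _)
    rw [le_div_iff₀ hX', ← abs_mul, sub_mul, div_mul_cancel₀ _ hX, abs_sub_comm]
    exact hc
  · rw [bumpCorr_eq_zero (lt_of_not_ge hc), mul_zero, mul_zero]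

/-- The kernel of the quadratic form `∫ χ F²` for the band-limited incidence function `F`. -/
noncomputable def bandKernel (u v X Y : ℝ) : ℝ :=
  slopeCorr u u X Y - slopeCorr u v X Y - slopeCorr v u X Y + slopeCorr v v X Y

theorem bandKernel_near {u v X Y R : ℝ} (hu : 0 < u) (hv : 0 < v)
    (hR : R ≤ 4 * u ∨ R ≤ max |X| |Y|) (hR0 : 0 < R) :
    bandKernel u v X Y ≤ 16 / R + 4 / v := by
  have h1 := slopeCorr_nonneg hu hv X Y
  have h2 := slopeCorr_nonneg hv hu X Y
  have h3 := slopeCorr_le_inv hv hv X Y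
  have h4 : slopeCorr u u X Y ≤ 16 / R := by
    by_cases hR' : R ≤ 4 * u
    · refine (slopeCorr_le_inv hu hu X Y).trans ?_
      rw [div_le_div_iff₀ hu hR0]; linarith
    have hR2 := hR.resolve_left hR'
    by_cases hz : 4 * |X| + (u + u) < |Y|
    · rw [slopeCorr_eq_zero hz]; positivity
    · have hXR : R ≤ 8 * |X| := by
        rcases le_max_iff.1 hR2 with h | h
        · have := abs_nonneg X; linarith
        · linarith
      have hX : 0 < |X| := by linarith
      refine (slopeCorr_self_le hu (abs_pos.1 hX) Y).trans ?_
      rw [div_le_div_iff₀ hX hR0]; linarith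
  unfold bandKernel
  linarith

theorem bandKernel_far {u v X Y R : ℝ} (hu : 0 < u) (huv : u ≤ v)
    (hR : R ≤ max |X| |Y|) (hR0 : 4 * v < R) :
    bandKernel u v X Y ≤ 512 * v / R ^ 2 := by
  have hv : 0 < v := by linarith
  by_cases hX : |X| < R / 8
  · have hY : R ≤ |Y| := by
      rcases le_max_iff.1 hR with h | h
      · linarith
      · exact h
    unfold bandKernel
    rw [slopeCorr_eq_zero (by linarith), slopeCorr_eq_zero (by linarith),
      slopeCorr_eq_zero (by linarith), slopeCorr_eq_zero (by linarith)]
    simp only [sub_zero, add_zero]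
    positivity
  · have hX8 : R / 8 ≤ |X| := le_of_not_gt hX
    have hX0 : 0 < |X| := by linarith
    have hX1 := abs_pos.1 hX0
    have h1 := (abs_le.1 (abs_slopeCorr_sub_le hu hu hX1 Y)).2
    have h2 := (abs_le.1 (abs_slopeCorr_sub_le hu hv hX1 Y)).1
    have h3 := (abs_le.1 (abs_slopeCorr_sub_le hv hu hX1 Y)).1
    have h4 := (abs_le.1 (abs_slopeCorr_sub_le hv hv hX1 Y)).2
    have h5 : bandKernel u v X Y ≤ 8 * v / |X| ^ 2 := by
      have : 8 * v / |X| ^ 2 ≥ (u + u) / |X| ^ 2 + (u + v) / |X| ^ 2 + (v + u) / |X| ^ 2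
          + (v + v) / |X| ^ 2 := by
        rw [← add_div, ← add_div, ← add_div]
        gcongr
        linarith
      unfold bandKernel
      linarith
    refine h5.trans ?_
    rw [div_le_div_iff₀ (by positivity) (by nlinarith)]
    have : R ^ 2 ≤ 64 * |X| ^ 2 := by nlinarith
    nlinarith

/-- The incidence function of a set `g` of points `(x i, y i)`, at the line of slope `z.1` and
height `z.2`, restricted to the band of widths between `u` and `v`. -/
noncomputable def bandIncidence (g : Finset ι) (x y : ι → ℝ) (u v : ℝ) (z : ℝ × ℝ) : ℝ :=
  ∑ i ∈ g, (bump u (y i - z.1 * x i - z.2) - bump v (y i - z.1 * x i - z.2))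

theorem cutoff_mul_bandIncidence_sq (g : Finset ι) (x y : ι → ℝ) (u v : ℝ) (z : ℝ × ℝ) :
    cutoff z.1 * bandIncidence g x y u v z ^ 2 = ∑ i ∈ g, ∑ j ∈ g,
      (cutoff z.1 * (bump u (y i - z.1 * x i - z.2) * bump u (y j - z.1 * x j - z.2))
      - cutoff z.1 * (bump u (y i - z.1 * x i - z.2) * bump v (y j - z.1 * x j - z.2))
      - cutoff z.1 * (bump v (y i - z.1 * x i - z.2) * bump u (y j - z.1 * x j - z.2))
      + cutoff z.1 * (bump v (y i - z.1 * x i - z.2) * bump v (y j - z.1 * x j - z.2))) := by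
  unfold bandIncidence
  rw [sq, Finset.sum_mul_sum, Finset.mul_sum]
  refine Finset.sum_congr rfl fun i _ => ?_
  rw [Finset.mul_sum]
  refine Finset.sum_congr rfl fun j _ => ?_
  ring

theorem integral_sub_sub_add {f₁ f₂ f₃ f₄ : ℝ × ℝ → ℝ} (h₁ : Integrable f₁) (h₂ : Integrable f₂)
    (h₃ : Integrable f₃) (h₄ : Integrable f₄) :
    (Integrable fun z => f₁ z - f₂ z - f₃ z + f₄ z) ∧
      ∫ z, (f₁ z - f₂ z - f₃ z + f₄ z) =
        (∫ z, f₁ z) - (∫ z, f₂ z) - (∫ z, f₃ z) + ∫ z, f₄ z := by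
  refine ⟨((h₁.sub h₂).sub h₃).add h₄, ?_⟩
  have e1 := integral_add ((h₁.sub h₂).sub h₃) h₄
  have e2 := integral_sub (h₁.sub h₂) h₃
  have e3 := integral_sub h₁ h₂
  simp only [Pi.sub_apply] at e1 e2
  rw [e1, e2, e3]

theorem integral_band_pair (x y x' y' : ℝ) {u v : ℝ} (hu : 0 < u) (hv : 0 < v) :
    (Integrable fun z : ℝ × ℝ =>
      (cutoff z.1 * (bump u (y - z.1 * x - z.2) * bump u (y' - z.1 * x' - z.2))
      - cutoff z.1 * (bump u (y - z.1 * x - z.2) * bump v (y' - z.1 * x' - z.2))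
      - cutoff z.1 * (bump v (y - z.1 * x - z.2) * bump u (y' - z.1 * x' - z.2))
      + cutoff z.1 * (bump v (y - z.1 * x - z.2) * bump v (y' - z.1 * x' - z.2)))) ∧
    ∫ z : ℝ × ℝ,
      (cutoff z.1 * (bump u (y - z.1 * x - z.2) * bump u (y' - z.1 * x' - z.2))
      - cutoff z.1 * (bump u (y - z.1 * x - z.2) * bump v (y' - z.1 * x' - z.2))
      - cutoff z.1 * (bump v (y - z.1 * x - z.2) * bump u (y' - z.1 * x' - z.2))
      + cutoff z.1 * (bump v (y - z.1 * x - z.2) * bump v (y' - z.1 * x' - z.2))) =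
      bandKernel u v (x' - x) (y' - y) := by
  obtain ⟨h, e⟩ := integral_sub_sub_add (integrable_line_prod hu hu x y x' y')
    (integrable_line_prod hu hv x y x' y') (integrable_line_prod hv hu x y x' y')
    (integrable_line_prod hv hv x y x' y')
  refine ⟨h, e.trans ?_⟩
  rw [integral_line_prod hu hu, integral_line_prod hu hv, integral_line_prod hv hu,
    integral_line_prod hv hv]
  rfl

theorem integrable_band (g : Finset ι) (x y : ι → ℝ) {u v : ℝ} (hu : 0 < u) (hv : 0 < v) :
    Integrable fun z : ℝ × ℝ => cutoff z.1 * bandIncidence g x y u v z ^ 2 := by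
  simp_rw [cutoff_mul_bandIncidence_sq]
  exact integrable_finsetSum _ fun i _ => integrable_finsetSum _ fun j _ =>
    (integral_band_pair (x i) (y i) (x j) (y j) hu hv).1

theorem integral_band (g : Finset ι) (x y : ι → ℝ) {u v : ℝ} (hu : 0 < u) (hv : 0 < v) :
    ∫ z : ℝ × ℝ, cutoff z.1 * bandIncidence g x y u v z ^ 2 =
      ∑ i ∈ g, ∑ j ∈ g, bandKernel u v (x j - x i) (y j - y i) := by
  simp_rw [cutoff_mul_bandIncidence_sq]
  have h := fun i j => integral_band_pair (x i) (y i) (x j) (y j) hu hv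
  rw [integral_finsetSum _ fun i _ => integrable_finsetSum _ fun j _ => (h i j).1]
  refine Finset.sum_congr rfl fun i _ => ?_
  rw [integral_finsetSum _ fun j _ => (h i j).1]
  exact Finset.sum_congr rfl fun j _ => (h i j).2

/-- The high-frequency count: if the band-limited incidence function is at least `lam` on a box
around each line of a finite family `S`, and the boxes overlap at most `N₀` times, then the family
is controlled by the energy of the points. -/
theorem card_mul_le_energy {τ : Type*} (S : Finset τ) (c e : τ → ℝ) (g : Finset ι) (x y : ι → ℝ)
    {u v α β lam N₀ : ℝ} (hu : 0 < u) (hv : 0 < v) (hα : 0 < α) (hα1 : α ≤ 1) (hβ : 0 < β)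
    (hlam : 0 < lam) (hN₀ : 0 ≤ N₀) (hc : ∀ t ∈ S, |c t| ≤ 2)
    (hF : ∀ t ∈ S, ∀ z : ℝ × ℝ, |z.1 - c t| ≤ α → |z.2 - e t| ≤ β →
      lam ≤ bandIncidence g x y u v z)
    (hover : ∀ z : ℝ × ℝ,
      ((S.filter fun t => |z.1 - c t| ≤ α ∧ |z.2 - e t| ≤ β).card : ℝ) ≤ N₀) :
    S.card * (4 * α * β) * lam ^ 2 ≤
      N₀ * ∑ i ∈ g, ∑ j ∈ g, bandKernel u v (x j - x i) (y j - y i) := by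
  set B : τ → Set (ℝ × ℝ) := fun t =>
    Set.Icc (c t - α) (c t + α) ×ˢ Set.Icc (e t - β) (e t + β) with hB
  have hmem : ∀ t z, z ∈ B t ↔ |z.1 - c t| ≤ α ∧ |z.2 - e t| ≤ β := by
    intro t z
    simp only [hB, Set.mem_prod, Set.mem_Icc, abs_le]
    constructor
    · rintro ⟨⟨h1, h2⟩, h3, h4⟩; refine ⟨⟨?_, ?_⟩, ?_, ?_⟩ <;> linarith
    · rintro ⟨⟨h1, h2⟩, h3, h4⟩; refine ⟨⟨?_, ?_⟩, ?_, ?_⟩ <;> linarith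
  have hBm : ∀ t, MeasurableSet (B t) := fun t => measurableSet_Icc.prod measurableSet_Icc
  have hvol : ∀ t, volume.real (B t) = 4 * α * β := by
    intro t
    rw [hB, measureReal_def, Measure.volume_eq_prod, Measure.prod_prod, Real.volume_Icc,
      Real.volume_Icc, ENNReal.toReal_mul, ENNReal.toReal_ofReal (by linarith),
      ENNReal.toReal_ofReal (by linarith)]
    ring
  have hfin : ∀ t, volume (B t) ≠ ⊤ := by
    intro t ht
    have := hvol t
    rw [measureReal_def, ht] at this
    simp only [ENNReal.toReal_top] at this
    have : 0 < 4 * α * β := by positivity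
    linarith
  have hint : ∀ t ∈ S, Integrable ((B t).indicator fun _ : ℝ × ℝ => lam ^ 2) := by
    intro t _
    rw [integrable_indicator_iff (hBm t)]
    exact integrableOn_const (hfin t)
  have hL : ∫ z, ∑ t ∈ S, (B t).indicator (fun _ : ℝ × ℝ => lam ^ 2) z =
      S.card * (4 * α * β) * lam ^ 2 := by
    rw [integral_finsetSum _ hint]
    simp_rw [integral_indicator_const _ (hBm _), hvol]
    simp
    ring
  rw [← hL, ← integral_band g x y hu hv, ← integral_const_mul]
  refine integral_mono (integrable_finsetSum _ hint) ((integrable_band g x y hu hv).const_mul _) ?_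
  intro z
  simp only
  have e1 : ∑ t ∈ S, (B t).indicator (fun _ : ℝ × ℝ => lam ^ 2) z =
      (S.filter fun t => |z.1 - c t| ≤ α ∧ |z.2 - e t| ≤ β).card * lam ^ 2 := by
    classical
    simp_rw [Set.indicator_apply, hmem]
    rw [← Finset.sum_filter, Finset.sum_const, nsmul_eq_mul]
  rw [e1]
  rcases (S.filter fun t => |z.1 - c t| ≤ α ∧ |z.2 - e t| ≤ β).eq_empty_or_nonempty with h0 | h0
  · rw [h0]
    simp only [Finset.card_empty, Nat.cast_zero, zero_mul]
    exact mul_nonneg hN₀ (mul_nonneg (cutoff_nonneg _) (sq_nonneg _))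
  · obtain ⟨t, ht⟩ := h0
    rw [Finset.mem_filter] at ht
    have hz3 : |z.1| ≤ 3 := by
      have := abs_sub_abs_le_abs_sub z.1 (c t)
      have := hc t ht.1
      linarith [ht.2.1]
    rw [cutoff_of_le hz3, one_mul]
    refine mul_le_mul (hover z) ?_ (by positivity) hN₀
    exact pow_le_pow_left₀ hlam.le (hF t ht.1 z ht.2.1 ht.2.2) 2

/-! ### Pruning and the energy of pruned sets -/

theorem scale_succ (n : ℕ) : scale (n + 1) = scale n / 2 := by
  unfold scale; rw [pow_succ]; field_simp

theorem scale_zero : scale 0 = 1 := by simp [scale]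

theorem scale_anti {k l : ℕ} (h : k ≤ l) : scale l ≤ scale k := by
  unfold scale
  exact inv_anti₀ (by positivity) (pow_le_pow_right₀ (by norm_num) h)

theorem scale_le_one (n : ℕ) : scale n ≤ 1 := scale_zero ▸ scale_anti (Nat.zero_le n)

/-- Dyadic pigeonholing of a number of `[0, 1]`, stopped at the scale `2⁻ᵀ`. -/
theorem exists_scale {r : ℝ} (hr : r ≤ 1) (T : ℕ) :
    ∃ t ≤ T, r ≤ scale t ∧ (t = T ∨ scale (t + 1) < r) := by
  induction T with
  | zero => exact ⟨0, le_rfl, by rwa [scale_zero], Or.inl rfl⟩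
  | succ T ih =>
    obtain ⟨t, ht, h1, h2⟩ := ih
    rcases h2 with rfl | h2
    · by_cases h : r ≤ scale (t + 1)
      · exact ⟨t + 1, le_rfl, h, Or.inl rfl⟩
      · exact ⟨t, ht.trans (Nat.le_succ _), h1, Or.inr (lt_of_not_ge h)⟩
    · exact ⟨t, ht.trans (Nat.le_succ _), h1, Or.inr h2⟩

/-- The sup-norm distance of the points `(x i, y i)` and `(x j, y j)`. -/
noncomputable def supDist (x y : ι → ℝ) (i j : ι) : ℝ := max |x j - x i| |y j - y i|

theorem supDist_comm (x y : ι → ℝ) (i j : ι) : supDist x y i j = supDist x y j i := by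
  unfold supDist; rw [abs_sub_comm, abs_sub_comm (y j)]

theorem supDist_triangle (x y : ι → ℝ) (i j k : ι) :
    supDist x y i k ≤ supDist x y i j + supDist x y j k := by
  unfold supDist
  refine max_le ?_ ?_
  · exact (abs_sub_le' _ _ _).trans (add_le_add (le_max_left _ _) (le_max_left _ _))
  · exact (abs_sub_le' _ _ _).trans (add_le_add (le_max_right _ _) (le_max_right _ _))
where abs_sub_le' (p q r : ℝ) : |r - p| ≤ |q - p| + |r - q| := by
        have := abs_add_le (q - p) (r - q)
        rwa [show q - p + (r - q) = r - p by ring] at this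

theorem bandKernel_le_of_dyadic {A T t : ℕ} {u v X Y : ℝ} (hT : A + 3 ≤ T) (hu : u = 8 * scale T)
    (hv : v = scale A) (htT : t ≤ T)
    (hst : t = T ∨ scale (t + 1) < max |X| |Y|) :
    bandKernel u v X Y ≤ if A + 3 ≤ t then 36 / scale t else 2048 * scale A / scale t ^ 2 := by
  subst hv
  have hT0 := scale_pos T
  have ht0 := scale_pos t
  have hA0 := scale_pos A
  have hu0 : 0 < u := by rw [hu]; positivity
  have huv : u ≤ scale A := by
    have : scale T ≤ scale (A + 3) := scale_anti hT
    rw [scale_succ, scale_succ, scale_succ] at this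
    rw [hu]; linarith
  have hnear : bandKernel u (scale A) X Y ≤ 32 / scale t + 4 / scale A := by
    have hR : scale (t + 1) ≤ 4 * u ∨ scale (t + 1) ≤ max |X| |Y| := by
      rcases hst with rfl | h
      · left
        rw [hu, scale_succ]; linarith
      · exact Or.inr h.le
    have := bandKernel_near hu0 hA0 hR (scale_pos _)
    rw [scale_succ] at this
    refine this.trans (le_of_eq ?_)
    field_simp
    ring
  split_ifs with h
  · have h1 : scale t ≤ scale A := scale_anti (by omega)
    have h2 : 4 / scale A ≤ 4 / scale t := by gcongr
    have h3 : 36 / scale t = 32 / scale t + 4 / scale t := by ring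
    linarith
  · by_cases h8 : scale t ≤ 8 * scale A
    · refine hnear.trans ?_
      rw [div_add_div _ _ ht0.ne' hA0.ne', div_le_div_iff₀ (by positivity) (by positivity)]
      have h1 : scale t ^ 2 ≤ 8 * scale A * scale t := by nlinarith
      have h2 : scale t ^ 3 ≤ 64 * scale A ^ 2 * scale t := by
        have : scale t ^ 2 ≤ 64 * scale A ^ 2 := by nlinarith
        calc scale t ^ 3 = scale t ^ 2 * scale t := by ring
          _ ≤ _ := by gcongr
      have h3 : scale A * scale t ^ 2 ≤ scale A * (8 * scale A * scale t) := by gcongr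
      have h4 : 0 < scale A * scale A * scale t := by positivity
      nlinarith
    · have hlt : scale (t + 1) < max |X| |Y| := by
        rcases hst with rfl | h'
        · omega
        · exact h'
      have := bandKernel_far (R := scale (t + 1)) (X := X) (Y := Y) hu0 huv hlt.le
        (by rw [scale_succ]; linarith)
      refine this.trans (le_of_eq ?_)
      rw [scale_succ]
      field_simp
      norm_num

/-- Summing the kernel over dyadic annuli. The number of points in a ball is assumed to be at most
linear in the radius below the scale `2⁻ᴬ` and at most quadratic above it, so that every annulus
contributes equally. -/
theorem sum_bandKernel_le {g : Finset ι} {x y : ι → ℝ} {i : ι} {A T : ℕ} {u v a₁ a₂ : ℝ}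
    (hT : A + 3 ≤ T) (hu : u = 8 * scale T) (hv : v = scale A) (ha₁ : 0 ≤ a₁) (ha₂ : 0 ≤ a₂)
    (h1 : ∀ j ∈ g, supDist x y i j ≤ 1)
    (hsmall : ∀ t, A + 3 ≤ t → t ≤ T →
      ((g.filter fun j => supDist x y i j ≤ scale t).card : ℝ) ≤ a₁ * scale t)
    (hlarge : ∀ t, t ≤ A + 2 →
      ((g.filter fun j => supDist x y i j ≤ scale t).card : ℝ) ≤ a₂ * scale t ^ 2) :
    ∑ j ∈ g, bandKernel u v (x j - x i) (y j - y i) ≤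
      (T + 1) * (36 * a₁ + 2048 * scale A * a₂) := by
  set w : ℕ → ℝ := fun t => if A + 3 ≤ t then 36 / scale t else 2048 * scale A / scale t ^ 2
    with hw
  have hA0 := scale_pos A
  have hw0 : ∀ t, 0 ≤ w t := by
    intro t
    have := scale_pos t
    simp only [hw]
    split_ifs <;> positivity
  have hle : ∀ j ∈ g, bandKernel u v (x j - x i) (y j - y i) ≤
      ∑ t ∈ Finset.range (T + 1), if supDist x y i j ≤ scale t then w t else 0 := by
    intro j hj
    obtain ⟨t, htT, hr, hst⟩ := exists_scale (h1 j hj) T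
    refine (bandKernel_le_of_dyadic hT hu hv htT hst).trans ?_
    refine le_trans (le_of_eq ?_) (Finset.single_le_sum (f := fun t =>
      if supDist x y i j ≤ scale t then w t else 0) (fun t _ => ?_)
      (Finset.mem_range.2 (Nat.lt_succ_of_le htT)))
    · simp only [if_pos hr, hw]
    · split_ifs
      · exact hw0 t
      · exact le_rfl
  refine (Finset.sum_le_sum hle).trans ?_
  rw [Finset.sum_comm]
  have hterm : ∀ t ∈ Finset.range (T + 1),
      (∑ j ∈ g, if supDist x y i j ≤ scale t then w t else 0) ≤
        36 * a₁ + 2048 * scale A * a₂ := by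
    intro t ht
    have htT := Nat.lt_succ_iff.1 (Finset.mem_range.1 ht)
    have ht0 := scale_pos t
    rw [← Finset.sum_filter, Finset.sum_const, nsmul_eq_mul]
    by_cases h : A + 3 ≤ t
    · have e : a₁ * scale t * w t = 36 * a₁ := by
        simp only [hw, if_pos h]; field_simp
      have := mul_le_mul_of_nonneg_right (hsmall t h htT) (hw0 t)
      have : 0 ≤ 2048 * scale A * a₂ := by positivity
      linarith
    · have e : a₂ * scale t ^ 2 * w t = 2048 * scale A * a₂ := by
        simp only [hw, if_neg h]; field_simp
      have := mul_le_mul_of_nonneg_right (hlarge t (by omega)) (hw0 t)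
      linarith
  refine (Finset.sum_le_sum hterm).trans (le_of_eq ?_)
  rw [Finset.sum_const, Finset.card_range, nsmul_eq_mul]
  push_cast
  ring

/-- If every cell of side `D` holds at most `B` points, then a ball of radius `r ≥ D / 4` holds
`O((r / D)² B)` points. -/
theorem card_ball_le [Fintype ι] {x y : ι → ℝ} {D B r : ℝ} (hD : 0 < D) (hr : D / 4 ≤ r)
    (cell : ι → ℤ × ℤ) (hcell : ∀ i, cell i = (⌊x i / D⌋, ⌊y i / D⌋))
    (hB : ∀ i, ((Finset.univ.filter fun j => cell j = cell i).card : ℝ) ≤ B) (i : ι) :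
    ((Finset.univ.filter fun j => supDist x y i j ≤ r).card : ℝ) ≤ 196 * (r / D) ^ 2 * B := by
  classical
  set H := Finset.univ.filter fun j => supDist x y i j ≤ r with hH
  set m : ℤ := ⌈r / D⌉ with hm
  have hfl : ∀ p q : ℝ, |q - p| ≤ r → |⌊q / D⌋ - ⌊p / D⌋| ≤ m := by
    intro p q hpq
    have h1 : |q / D - p / D| ≤ r / D := by
      rw [← sub_div, abs_div, abs_of_pos hD]; gcongr
    have h2 := Int.le_ceil (r / D)
    rw [← hm] at h2
    have h3 := (abs_le.1 (h1.trans h2))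
    have f1 := Int.floor_le (q / D)
    have f2 := Int.lt_floor_add_one (q / D)
    have f3 := Int.floor_le (p / D)
    have f4 := Int.lt_floor_add_one (p / D)
    rw [abs_le]
    constructor
    · have : (-(m : ℝ) - 1) < ⌊q / D⌋ - ⌊p / D⌋ := by linarith
      have : (-m - 1 : ℤ) < ⌊q / D⌋ - ⌊p / D⌋ := by exact_mod_cast this
      omega
    · have : ((⌊q / D⌋ : ℝ) - ⌊p / D⌋) < m + 1 := by linarith
      have : (⌊q / D⌋ - ⌊p / D⌋ : ℤ) < m + 1 := by exact_mod_cast this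
      omega
  have hm0 : 0 < m := Int.ceil_pos.2 (by have : 0 < r := by linarith
                                         positivity)
  have himg : H.image cell ⊆ Finset.Icc ((cell i).1 - m) ((cell i).1 + m) ×ˢ
      Finset.Icc ((cell i).2 - m) ((cell i).2 + m) := by
    intro q hq
    obtain ⟨j, hj, rfl⟩ := Finset.mem_image.1 hq
    have hj' := (Finset.mem_filter.1 hj).2
    have a1 := abs_le.1 (hfl (x i) (x j) ((le_max_left _ _).trans hj'))
    have a2 := abs_le.1 (hfl (y i) (y j) ((le_max_right _ _).trans hj'))
    rw [hcell i, hcell j]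
    simp only [Finset.mem_product, Finset.mem_Icc]
    omega
  have hcard : ((H.image cell).card : ℝ) ≤ (2 * m + 1) ^ 2 := by
    have := Finset.card_le_card himg
    rw [Finset.card_product, Int.card_Icc, Int.card_Icc] at this
    have e : ∀ z : ℤ, (z + m + 1 - (z - m)).toNat = (2 * m + 1).toNat := by intro z; congr 1; ring
    rw [e, e] at this
    have h2 : (((2 * m + 1).toNat : ℕ) : ℝ) = 2 * m + 1 := by
      have : (((2 * m + 1).toNat : ℕ) : ℤ) = 2 * m + 1 := Int.toNat_of_nonneg (by omega)
      exact_mod_cast this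
    have h3 : ((H.image cell).card : ℝ) ≤
        (((2 * m + 1).toNat : ℕ) : ℝ) * (((2 * m + 1).toNat : ℕ) : ℝ) := by exact_mod_cast this
    rw [h2] at h3
    linarith [sq (2 * (m : ℝ) + 1)]
  have hB0 : 0 ≤ B := (Nat.cast_nonneg _).trans (hB i)
  have hsum : (H.card : ℝ) ≤ (H.image cell).card * B := by
    rw [Finset.card_eq_sum_card_image cell H]
    push_cast
    rw [← nsmul_eq_mul]
    refine Finset.sum_le_card_nsmul _ _ _ ?_
    intro q hq
    obtain ⟨j, hj, rfl⟩ := Finset.mem_image.1 hq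
    refine le_trans ?_ (hB j)
    exact_mod_cast Finset.card_le_card (Finset.filter_subset_filter _ (Finset.subset_univ _))
  refine hsum.trans ?_
  refine mul_le_mul_of_nonneg_right (hcard.trans ?_) hB0
  have h1 : (m : ℝ) < r / D + 1 := Int.ceil_lt_add_one _
  have h2 : 1 / 4 ≤ r / D := by rw [le_div_iff₀ hD]; linarith
  have h3 : (0 : ℝ) < m := by exact_mod_cast hm0
  have h4 : (2 * (m : ℝ) + 1) ≤ 14 * (r / D) := by linarith
  calc (2 * (m : ℝ) + 1) ^ 2 ≤ (14 * (r / D)) ^ 2 := pow_le_pow_left₀ (by linarith) h4 2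
    _ = _ := by ring

/-- The successive prunings of the point set: at the `l`-th step the points are removed whose
ball of radius `2^(-A-l-3)` still contains more than `θ 2^(-A-l-1)` points. -/
noncomputable def pruned [Fintype ι] (x y : ι → ℝ) (A : ℕ) (θ : ℝ) : ℕ → Finset ι
  | 0 => Finset.univ
  | l + 1 => (pruned x y A θ l).filter fun i =>
      (((pruned x y A θ l).filter fun j => supDist x y i j ≤ scale (A + l + 3)).card : ℝ) ≤
        θ * scale (A + l + 1)

theorem pruned_succ_subset [Fintype ι] (x y : ι → ℝ) (A : ℕ) (θ : ℝ) (l : ℕ) :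
    pruned x y A θ (l + 1) ⊆ pruned x y A θ l := Finset.filter_subset _ _

theorem pruned_anti [Fintype ι] (x y : ι → ℝ) (A : ℕ) (θ : ℝ) {k l : ℕ} (h : k ≤ l) :
    pruned x y A θ l ⊆ pruned x y A θ k := by
  induction h with
  | refl => exact subset_rfl
  | step _ ih => exact (pruned_succ_subset x y A θ _).trans ih

theorem card_ball_pruned_le [Fintype ι] {x y : ι → ℝ} {A : ℕ} {θ : ℝ} {l k : ℕ} (hk : k + 1 ≤ l)
    {i : ι} (hi : i ∈ pruned x y A θ l) :
    (((pruned x y A θ l).filter fun j => supDist x y i j ≤ scale (A + k + 3)).card : ℝ) ≤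
      θ * scale (A + k + 1) := by
  have h1 := pruned_anti x y A θ hk hi
  rw [pruned, Finset.mem_filter] at h1
  refine le_trans ?_ h1.2
  exact_mod_cast Finset.card_le_card
    (Finset.filter_subset_filter _ (pruned_anti x y A θ (by omega)))

/-- The energy of a pruned set of points: balls of radius below `2⁻ᴬ` are controlled by the pruning,
larger ones by the number `B` of points per cell. -/
theorem energy_pruned_le [Fintype ι] {x y : ι → ℝ} {A l : ℕ} {θ B : ℝ} (hl : 1 ≤ l)
    (hθ : 0 ≤ θ) (hB0 : 0 ≤ B) (cell : ι → ℤ × ℤ)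
    (hcell : ∀ i, cell i = (⌊x i / scale A⌋, ⌊y i / scale A⌋))
    (hB : ∀ i, ((Finset.univ.filter fun j => cell j = cell i).card : ℝ) ≤ B)
    (h1 : ∀ i j, supDist x y i j ≤ 1) {g : Finset ι} (hg : g ⊆ pruned x y A θ l) :
    ∑ i ∈ g, ∑ j ∈ g, bandKernel (2 * scale (A + l)) (scale A) (x j - x i) (y j - y i) ≤
      g.card * ((A + l + 3 : ℕ) * (144 * θ + 401408 * (B / scale A))) := by
  rw [← nsmul_eq_mul]
  refine Finset.sum_le_card_nsmul _ _ _ fun i hi => ?_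
  have hA0 := scale_pos A
  have := sum_bandKernel_le (g := g) (x := x) (y := y) (i := i) (A := A) (T := A + l + 2)
    (u := 2 * scale (A + l)) (v := scale A) (a₁ := 4 * θ) (a₂ := 196 * B / scale A ^ 2)
    (by omega) (by rw [scale_succ, scale_succ]; ring) rfl (by positivity) (by positivity)
    (fun j _ => h1 i j) ?_ ?_
  · refine this.trans (le_of_eq ?_)
    push_cast
    field_simp
    ring
  · intro t ht htT
    obtain ⟨k, rfl⟩ : ∃ k, t = A + k + 3 := ⟨t - A - 3, by omega⟩
    have h2 := card_ball_pruned_le (k := k) (by omega) (hg hi)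
    have h3 : θ * scale (A + k + 1) = 4 * θ * scale (A + k + 3) := by
      rw [scale_succ (A + k + 2), scale_succ (A + k + 1)]; ring
    rw [← h3]
    refine le_trans ?_ h2
    exact_mod_cast Finset.card_le_card (Finset.filter_subset_filter _ hg)
  · intro t ht
    have h2 : scale A / 4 ≤ scale t := by
      have := scale_anti ht
      rw [scale_succ, scale_succ] at this
      linarith
    have h3 := card_ball_le hA0 h2 cell hcell hB i
    have h4 : 196 * (scale t / scale A) ^ 2 * B = 196 * B / scale A ^ 2 * scale t ^ 2 := by
      field_simp
    rw [← h4]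
    refine le_trans ?_ h3
    exact_mod_cast Finset.card_le_card (Finset.filter_subset_filter _ (Finset.subset_univ _))

/-! ### Counting lemmas -/

/-- If many pairs of points of `A` are `2⁻ʰ`-separated, then a positive proportion (up to a power
of `h`) of all pairs lies in one interval of length comparable to the distance of the pairs. -/
theorem exists_localized_pairs (A : Finset ι) (G : Finset (ι × ι)) (hG : G ⊆ A ×ˢ A) (x : ι → ℝ)
    (hx : ∀ i, 0 ≤ x i ∧ x i < 1) (h : ℕ) (hsep : ∀ p ∈ G, scale h ≤ |x p.1 - x p.2|)
    (hcard : (A.card : ℝ) ^ 2 / 2 ≤ G.card) :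
    ∃ k ≤ h, ∃ i : ℕ, i < 2 ^ k ∧ (A.card : ℝ) ^ 2 / (36 * (h + 1) ^ 2) ≤
      (G.filter fun p => scale (k + 1) ≤ |x p.1 - x p.2| ∧
        (i * scale k ≤ x p.1 ∧ x p.1 < (i + 2) * scale k) ∧
        (i * scale k ≤ x p.2 ∧ x p.2 < (i + 2) * scale k)).card := by
  classical
  rcases Finset.eq_empty_or_nonempty A with rfl | hA
  · exact ⟨0, Nat.zero_le _, 0, by simp, by simp⟩
  have hA0 : (0 : ℝ) < A.card := by exact_mod_cast hA.card_pos
  by_contra! hcon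
  set F : ℕ → ℕ → Finset (ι × ι) := fun k i => G.filter fun p => scale (k + 1) ≤ |x p.1 - x p.2| ∧
        (i * scale k ≤ x p.1 ∧ x p.1 < (i + 2) * scale k) ∧
        (i * scale k ≤ x p.2 ∧ x p.2 < (i + 2) * scale k) with hF
  set I : ℕ → ℕ → Finset ι := fun k i =>
    A.filter fun q => i * scale k ≤ x q ∧ x q < (i + 2) * scale k with hI
  -- every pair of `G` lies in one of the sets `F k i`
  have hcover : G ⊆ (Finset.range (h + 1)).biUnion fun k =>
      (Finset.range (2 ^ k)).biUnion fun i => F k i := by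
    intro p hp
    have hp1 := hx p.1
    have hp2 := hx p.2
    obtain ⟨k, hk, hk1, hk2⟩ := exists_scale (r := |x p.1 - x p.2|)
      (by rw [abs_le]; constructor <;> linarith) h
    have hk0 := scale_pos k
    have hk3 : scale (k + 1) ≤ |x p.1 - x p.2| := by
      rcases hk2 with rfl | h'
      · exact (scale_anti (Nat.le_succ _)).trans (hsep p hp)
      · exact h'.le
    set m := min (x p.1) (x p.2) with hm
    have hm0 : 0 ≤ m := le_min hp1.1 hp2.1
    have hm1 : m < 1 := (min_le_left _ _).trans_lt hp1.2
    have hfl := Nat.floor_le (div_nonneg hm0 hk0.le)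
    have hfl2 := Nat.lt_floor_add_one (m / scale k)
    rw [le_div_iff₀ hk0] at hfl
    rw [div_lt_iff₀ hk0] at hfl2
    have hlt : ⌊m / scale k⌋₊ < 2 ^ k := by
      rw [Nat.floor_lt (div_nonneg hm0 hk0.le), div_lt_iff₀ hk0]
      have : ((2 ^ k : ℕ) : ℝ) * scale k = 1 := by
        unfold scale; push_cast; field_simp
      linarith
    simp only [Finset.mem_biUnion, Finset.mem_range]
    refine ⟨k, Nat.lt_succ_of_le hk, _, hlt, ?_⟩
    simp only [hF, Finset.mem_filter]
    have hab := abs_le.1 hk1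
    have h1 : m ≤ x p.1 := min_le_left _ _
    have h2 : m ≤ x p.2 := min_le_right _ _
    have h3 : x p.1 ≤ m + scale k ∧ x p.2 ≤ m + scale k := by
      rcases min_choice (x p.1) (x p.2) with h' | h' <;> rw [hm, h'] <;> constructor <;> linarith
    refine ⟨hp, hk3, ⟨by linarith, by linarith [h3.1]⟩, by linarith, by linarith [h3.2]⟩
  have hle1 : (G.card : ℝ) ≤ ∑ k ∈ Finset.range (h + 1), ∑ i ∈ Finset.range (2 ^ k),
      ((F k i).card : ℝ) := by
    have h1 := (Finset.card_le_card hcover).trans Finset.card_biUnion_le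
    have h2 : ∑ k ∈ Finset.range (h + 1),
        ((Finset.range (2 ^ k)).biUnion fun i => F k i).card ≤
        ∑ k ∈ Finset.range (h + 1), ∑ i ∈ Finset.range (2 ^ k), (F k i).card :=
      Finset.sum_le_sum fun k _ => Finset.card_biUnion_le
    exact_mod_cast h1.trans h2
  -- each set is smaller than the geometric mean of its two bounds
  have hFI : ∀ k ∈ Finset.range (h + 1), ∀ i ∈ Finset.range (2 ^ k),
      ((F k i).card : ℝ) ≤ A.card / (6 * (h + 1)) * (I k i).card := by
    intro k hk i hi
    have h1 := (hcon k (Nat.lt_succ_iff.1 (Finset.mem_range.1 hk)) i (Finset.mem_range.1 hi)).le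
    have h2 : ((F k i).card : ℝ) ≤ ((I k i).card : ℝ) ^ 2 := by
      have : F k i ⊆ I k i ×ˢ I k i := by
        intro p hp
        simp only [hF, Finset.mem_filter] at hp
        have := Finset.mem_product.1 (hG hp.1)
        simp only [hI, Finset.mem_product, Finset.mem_filter]
        exact ⟨⟨this.1, hp.2.2.1⟩, this.2, hp.2.2.2⟩
      have := Finset.card_le_card this
      rw [Finset.card_product, ← sq] at this
      exact_mod_cast this
    refine (abs_le_of_sq_le_sq' ?_ (by positivity)).2
    calc ((F k i).card : ℝ) ^ 2 = (F k i).card * (F k i).card := sq _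
      _ ≤ ((A.card : ℝ) ^ 2 / (36 * (h + 1) ^ 2)) * ((I k i).card : ℝ) ^ 2 :=
          mul_le_mul h1 h2 (by positivity) (by positivity)
      _ = _ := by field_simp; ring
  have hsumI : ∀ k, ∑ i ∈ Finset.range (2 ^ k), ((I k i).card : ℝ) ≤ 2 * A.card := by
    intro k
    have hk0 := scale_pos k
    have e : ∀ i, ((I k i).card : ℝ) =
        ∑ q ∈ A, if i * scale k ≤ x q ∧ x q < (i + 2) * scale k then (1 : ℝ) else 0 := by
      intro i
      simp only [hI, Finset.card_filter]
      push_cast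
      rfl
    simp_rw [e]
    rw [Finset.sum_comm]
    have : ∀ q ∈ A, (∑ i ∈ Finset.range (2 ^ k),
        if i * scale k ≤ x q ∧ x q < (i + 2) * scale k then (1 : ℝ) else 0) ≤ 2 := by
      intro q _
      rw [← Finset.sum_filter, Finset.sum_const, nsmul_eq_mul, mul_one]
      set N := ⌊x q / scale k⌋₊ with hN
      have hfl := Nat.floor_le (div_nonneg (hx q).1 hk0.le)
      have hfl2 := Nat.lt_floor_add_one (x q / scale k)
      rw [le_div_iff₀ hk0, ← hN] at hfl
      rw [div_lt_iff₀ hk0, ← hN] at hfl2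
      have : ((Finset.range (2 ^ k)).filter fun i : ℕ =>
          i * scale k ≤ x q ∧ x q < (i + 2) * scale k) ⊆ Finset.Icc (N - 1) N := by
        intro i hi
        have hi' := (Finset.mem_filter.1 hi).2
        have b1 : (i : ℝ) * scale k < (N + 1) * scale k := by linarith
        have b2 : (N : ℝ) * scale k < (i + 2) * scale k := by linarith
        have b3 := lt_of_mul_lt_mul_right b1 hk0.le
        have b4 := lt_of_mul_lt_mul_right b2 hk0.le
        have b5 : i < N + 1 := by exact_mod_cast b3
        have b6 : N < i + 2 := by exact_mod_cast b4
        rw [Finset.mem_Icc]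
        omega
      have := Finset.card_le_card this
      rw [Nat.card_Icc] at this
      have h2 : N + 1 - (N - 1) ≤ 2 := by omega
      exact_mod_cast this.trans h2
    refine (Finset.sum_le_sum this).trans (le_of_eq ?_)
    rw [Finset.sum_const, nsmul_eq_mul, mul_comm]
  have hfin : (G.card : ℝ) ≤ (A.card : ℝ) ^ 2 / 3 := by
    calc (G.card : ℝ) ≤ ∑ k ∈ Finset.range (h + 1), ∑ i ∈ Finset.range (2 ^ k),
          ((F k i).card : ℝ) := hle1
      _ ≤ ∑ k ∈ Finset.range (h + 1), ∑ i ∈ Finset.range (2 ^ k),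
          A.card / (6 * (h + 1)) * ((I k i).card : ℝ) :=
          Finset.sum_le_sum fun k hk => Finset.sum_le_sum fun i hi => hFI k hk i hi
      _ ≤ ∑ k ∈ Finset.range (h + 1), A.card / (6 * (h + 1)) * (2 * (A.card : ℝ)) := by
          refine Finset.sum_le_sum fun k _ => ?_
          rw [← Finset.mul_sum]
          exact mul_le_mul_of_nonneg_left (hsumI k) (by positivity)
      _ = _ := by
          rw [Finset.sum_const, Finset.card_range, nsmul_eq_mul]
          push_cast
          field_simp
          norm_num
  nlinarith [sq_pos_of_pos hA0]

/-- Few tubes pass through two points at horizontal distance at least `d / 2`. -/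
theorem card_lines_le (S : Finset (ℤ × ℤ)) {δ d x y x' y' : ℝ} (hδ : 0 < δ) (hd : 0 < d)
    (hd1 : d ≤ 1) (hxx : d / 2 ≤ |x - x'|)
    (h1 : ∀ t ∈ S, |y - t.1 * δ * x - t.2 * δ| ≤ 12 * δ)
    (h2 : ∀ t ∈ S, |y' - t.1 * δ * x' - t.2 * δ| ≤ 12 * δ) :
    (S.card : ℝ) ≤ 10000 / d := by
  classical
  have hfst : ∀ t ∈ S, ∀ t' ∈ S, |(t.1 : ℝ) - t'.1| ≤ 96 / d := by
    intro t ht t' ht'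
    have e : ((t.1 : ℝ) - t'.1) * (x - x') * δ =
        (y - t'.1 * δ * x - t'.2 * δ) - (y - t.1 * δ * x - t.2 * δ)
        - ((y' - t'.1 * δ * x' - t'.2 * δ) - (y' - t.1 * δ * x' - t.2 * δ)) := by ring
    have a1 := abs_le.1 (h1 t ht)
    have a2 := abs_le.1 (h1 t' ht')
    have a3 := abs_le.1 (h2 t ht)
    have a4 := abs_le.1 (h2 t' ht')
    have h3 : |((t.1 : ℝ) - t'.1) * (x - x') * δ| ≤ 48 * δ := by
      rw [e, abs_le]; constructor <;> linarith
    rw [abs_mul, abs_mul, abs_of_pos hδ] at h3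
    have h4 := le_of_mul_le_mul_right h3 hδ
    rw [le_div_iff₀ hd]
    have := mul_le_mul_of_nonneg_left hxx (abs_nonneg ((t.1 : ℝ) - t'.1))
    linarith
  have hsnd : ∀ t ∈ S, ∀ t' ∈ S, t.1 = t'.1 → |t.2 - t'.2| ≤ 24 := by
    intro t ht t' ht' htt
    have a1 := abs_le.1 (h1 t ht)
    have a2 := abs_le.1 (h1 t' ht')
    rw [htt] at a1
    have b1 : ((t.2 : ℝ) - t'.2) * δ ≤ 24 * δ := by linarith
    have b2 : (-24) * δ ≤ ((t.2 : ℝ) - t'.2) * δ := by linarith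
    have c1 := le_of_mul_le_mul_right b1 hδ
    have c2 := le_of_mul_le_mul_right b2 hδ
    rw [abs_le]
    constructor
    · have : ((-24 : ℤ) : ℝ) ≤ ((t.2 - t'.2 : ℤ) : ℝ) := by push_cast; linarith
      exact_mod_cast this
    · have : ((t.2 - t'.2 : ℤ) : ℝ) ≤ ((24 : ℤ) : ℝ) := by push_cast; linarith
      exact_mod_cast this
  have hfib : ∀ q ∈ S.image Prod.fst, (S.filter fun t => t.1 = q).card ≤ 49 := by
    intro q hq
    obtain ⟨t₀, ht₀, rfl⟩ := Finset.mem_image.1 hq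
    have : (S.filter fun t => t.1 = t₀.1) ⊆ {t₀.1} ×ˢ Finset.Icc (t₀.2 - 24) (t₀.2 + 24) := by
      intro t ht
      have ht' := Finset.mem_filter.1 ht
      have := abs_le.1 (hsnd t ht'.1 t₀ ht₀ ht'.2)
      simp only [Finset.mem_product, Finset.mem_singleton, Finset.mem_Icc]
      exact ⟨ht'.2, by omega, by omega⟩
    have := Finset.card_le_card this
    rw [Finset.card_product, Finset.card_singleton, Int.card_Icc] at this
    omega
  have hS : S.card ≤ (S.image Prod.fst).card * 49 := by
    rw [Finset.card_eq_sum_card_image Prod.fst S]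
    exact Finset.sum_le_card_nsmul _ _ _ hfib
  have himg : ((S.image Prod.fst).card : ℝ) ≤ 193 / d := by
    rcases S.eq_empty_or_nonempty with rfl | ⟨t₀, ht₀⟩
    · simp; positivity
    set m : ℤ := ⌊96 / d⌋ with hm
    have hm0 : 0 ≤ m := Int.floor_nonneg.2 (by positivity)
    have : S.image Prod.fst ⊆ Finset.Icc (t₀.1 - m) (t₀.1 + m) := by
      intro q hq
      obtain ⟨t, ht, rfl⟩ := Finset.mem_image.1 hq
      have h3 : |t.1 - t₀.1| ≤ m := by
        rw [hm, Int.le_floor]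
        push_cast
        exact hfst t ht t₀ ht₀
      have := abs_le.1 h3
      rw [Finset.mem_Icc]
      constructor <;> linarith
    have h4 := Finset.card_le_card this
    rw [Int.card_Icc] at h4
    have h5 : (((S.image Prod.fst).card : ℤ)) ≤ 2 * m + 1 := by
      have : ((t₀.1 + m + 1 - (t₀.1 - m)).toNat : ℤ) = 2 * m + 1 := by
        rw [Int.toNat_of_nonneg (by omega)]; ring
      omega
    have h6 : ((S.image Prod.fst).card : ℝ) ≤ 2 * m + 1 := by exact_mod_cast h5
    have h7 : (m : ℝ) ≤ 96 / d := Int.floor_le _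
    have h8 : 1 ≤ 1 / d := by rw [le_div_iff₀ hd]; linarith
    have h9 : 193 / d = 2 * (96 / d) + 1 / d := by ring
    linarith
  have hS' : (S.card : ℝ) ≤ (S.image Prod.fst).card * 49 := by exact_mod_cast hS
  have : 193 / d * 49 ≤ 10000 / d := by rw [div_mul_eq_mul_div]; gcongr; norm_num
  linarith

/-- Points in different cells have disjoint balls, so few cells contain a point whose ball holds
many points of `H`. -/
theorem card_cells_mul_le {κ : Type*} [DecidableEq κ] (D H : Finset ι) (cell : ι → κ)
    (dist : ι → ι → ℝ) {R β : ℝ}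
    (hsep : ∀ i ∈ D, ∀ j ∈ D, cell i ≠ cell j → ∀ q, ¬ (dist i q ≤ R ∧ dist j q ≤ R))
    (hβ : ∀ i ∈ D, β ≤ (H.filter fun q => dist i q ≤ R).card) :
    (D.image cell).card * β ≤ H.card := by
  classical
  rcases D.eq_empty_or_nonempty with rfl | ⟨i₀, -⟩
  · simp
  have : Nonempty ι := ⟨i₀⟩
  have hrep : ∀ c ∈ D.image cell, ∃ i ∈ D, cell i = c := fun c hc => Finset.mem_image.1 hc
  choose! s hs hsc using hrep
  have hsub : ((D.image cell).biUnion fun c => H.filter fun q => dist (s c) q ≤ R) ⊆ H :=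
    Finset.biUnion_subset.2 fun c _ => Finset.filter_subset _ _
  have hdisj : ((D.image cell : Finset κ) : Set κ).PairwiseDisjoint
      fun c => H.filter fun q => dist (s c) q ≤ R := by
    intro c hc c' hc' hcc
    rw [Function.onFun, Finset.disjoint_left]
    intro q hq hq'
    refine hsep (s c) (hs c hc) (s c') (hs c' hc') ?_ q
      ⟨(Finset.mem_filter.1 hq).2, (Finset.mem_filter.1 hq').2⟩
    rwa [hsc c hc, hsc c' hc']
  have h1 := Finset.card_le_card hsub
  rw [Finset.card_biUnion hdisj] at h1
  have h2 : ((D.image cell).card : ℝ) * β ≤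
      ∑ c ∈ D.image cell, ((H.filter fun q => dist (s c) q ≤ R).card : ℝ) := by
    rw [← nsmul_eq_mul]
    exact Finset.card_nsmul_le_sum _ _ _ fun c hc => hβ _ (hs c hc)
  exact h2.trans (by exact_mod_cast h1)

/-! ### The crossing scale of a rich line -/

/-- The vertical distance of the `q`-th point to the line `y = c x + e`. -/
noncomputable def lineDist (x y : ι → ℝ) (c e : ℝ) (q : ι) : ℝ := |y q - c * x q - e|

/-- The points of the `l`-th pruning in the vertical slab around two adjacent dyadic intervals of
length `2⁻ᵏ`, enlarged by `2⁻ᴬ` on both sides. -/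
noncomputable def localPruned [Fintype ι] (x y : ι → ℝ) (A : ℕ) (θ : ℝ) (l k i : ℕ) : Finset ι :=
  (pruned x y A θ l).filter fun q =>
    i * scale k - scale A ≤ x q ∧ x q ≤ (i + 2) * scale k + scale A

theorem lineDist_le_add {x y : ι → ℝ} {c e : ℝ} (hc : |c| ≤ 2) (i j : ι) :
    lineDist x y c e j ≤ lineDist x y c e i + 3 * supDist x y i j := by
  unfold lineDist
  have e1 : y j - c * x j - e = (y i - c * x i - e) + ((y j - y i) - c * (x j - x i)) := by ring
  have h1 : |y j - y i| ≤ supDist x y i j := le_max_right _ _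
  have h2 : |x j - x i| ≤ supDist x y i j := le_max_left _ _
  have h3 : |c * (x j - x i)| ≤ 2 * supDist x y i j := by
    rw [abs_mul]
    exact mul_le_mul hc h2 (abs_nonneg _) (by norm_num)
  rw [e1]
  refine (abs_add_le _ _).trans ?_
  have := abs_sub (y j - y i) (c * (x j - x i))
  linarith

/-- If a line has few points of the first prunings at the corresponding scales, then only few of
its cells are affected by the prunings. -/
theorem card_pruned_cells_mul_le [Fintype ι] [DecidableEq ι] {κ : Type*} [DecidableEq κ]
    {x y : ι → ℝ} {A n k i : ℕ} {θ Λ c e : ℝ} (hc : |c| ≤ 2) (hθ : 0 ≤ θ) {cell : ι → κ}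
    (hsep : ∀ i j, cell i ≠ cell j → scale A / 2 ≤ supDist x y i j)
    (S : Finset ι) (hS : ∀ q ∈ S, lineDist x y c e q ≤ 12 * scale n)
    (hSx : ∀ q ∈ S, i * scale k ≤ x q ∧ x q < (i + 2) * scale k) (l : ℕ) (hl : A + l + 4 ≤ n)
    (hcross : ∀ l' < l, (((localPruned x y A θ l' k i).filter fun q =>
      lineDist x y c e q ≤ scale (A + l')).card : ℝ) ≤ Λ * scale (A + l')) :
    (((S.filter fun q => q ∉ pruned x y A θ l).image cell).card : ℝ) * θ ≤ 2 * l * Λ := by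
  induction l with
  | zero => simp [pruned]
  | succ l ih =>
    have ih := ih (by omega) fun l' h => hcross l' (h.trans (Nat.lt_succ_self _))
    set D := S.filter fun q => q ∈ pruned x y A θ l ∧ q ∉ pruned x y A θ (l + 1) with hD
    have hsplit : (S.filter fun q => q ∉ pruned x y A θ (l + 1)).image cell ⊆
        ((S.filter fun q => q ∉ pruned x y A θ l).image cell) ∪ D.image cell := by
      rw [← Finset.image_union]
      refine Finset.image_subset_image fun q hq => ?_
      simp only [hD, Finset.mem_union, Finset.mem_filter] at hq ⊢
      tauto
    set H := (localPruned x y A θ l k i).filter fun q => lineDist x y c e q ≤ scale (A + l) with hH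
    have s1 : scale (A + l) = 2 * scale (A + l + 1) := by rw [scale_succ]; ring
    have s2 : scale (A + l + 1) = 4 * scale (A + l + 3) := by
      rw [scale_succ (A + l + 2), scale_succ (A + l + 1)]; ring
    have s3 : scale (A + l + 3) ≤ scale A / 8 := by
      have : scale (A + l + 3) ≤ scale (A + 3) := scale_anti (by omega)
      rw [scale_succ (A + 2), scale_succ (A + 1), scale_succ A] at this
      linarith
    have s4 : 16 * scale n ≤ scale (A + l + 1) := by
      have : scale n ≤ scale (A + l + 1 + 4) := scale_anti (by omega)
      rw [scale_succ, scale_succ, scale_succ, scale_succ] at this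
      linarith
    have hp := scale_pos (A + l + 3)
    have hA0 := scale_pos A
    have hcells : ((D.image cell).card : ℝ) * (θ * scale (A + l + 1)) ≤ H.card := by
      refine card_cells_mul_le D H cell (supDist x y) (R := scale (A + l + 3)) ?_ ?_
      · rintro i - j - hij q ⟨h1, h2⟩
        have h3 := hsep i j hij
        have h4 := supDist_triangle x y i q j
        rw [supDist_comm x y q j] at h4
        linarith
      · intro j hj
        have hj' := Finset.mem_filter.1 hj
        have h1 : θ * scale (A + l + 1) < (((pruned x y A θ l).filter fun q =>
            supDist x y j q ≤ scale (A + l + 3)).card : ℝ) := by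
          by_contra hcon
          refine hj'.2.2 ?_
          rw [pruned, Finset.mem_filter]
          exact ⟨hj'.2.1, le_of_not_gt hcon⟩
        refine h1.le.trans ?_
        have : ((pruned x y A θ l).filter fun q => supDist x y j q ≤ scale (A + l + 3)) ⊆
            H.filter fun q => supDist x y j q ≤ scale (A + l + 3) := by
          intro q hq
          obtain ⟨hq1, hq2⟩ := Finset.mem_filter.1 hq
          have h2 := hSx j hj'.1
          have h3 : |x q - x j| ≤ scale (A + l + 3) := (le_max_left _ _).trans hq2
          have h4 := abs_le.1 h3
          have h5 := lineDist_le_add (e := e) (x := x) (y := y) hc j q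
          have h6 := hS j hj'.1
          simp only [hH, localPruned, Finset.mem_filter]
          refine ⟨⟨⟨hq1, ?_, ?_⟩, ?_⟩, hq2⟩
          · linarith
          · linarith
          · linarith
        exact_mod_cast Finset.card_le_card this
    have hc1 : (H.card : ℝ) ≤ Λ * scale (A + l) := hcross l (Nat.lt_succ_self _)
    have h7 : ((D.image cell).card : ℝ) * θ ≤ 2 * Λ := by
      have h8 : ((D.image cell).card : ℝ) * θ * scale (A + l + 1) ≤ 2 * Λ * scale (A + l + 1) := by
        have := hcells.trans hc1
        rw [s1] at this
        linarith
      exact le_of_mul_le_mul_right h8 (scale_pos _)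
    have h9 : (((S.filter fun q => q ∉ pruned x y A θ (l + 1)).image cell).card : ℝ) ≤
        ((S.filter fun q => q ∉ pruned x y A θ l).image cell).card + (D.image cell).card := by
      exact_mod_cast (Finset.card_le_card hsplit).trans (Finset.card_union_le _ _)
    have h10 := mul_le_mul_of_nonneg_right h9 hθ
    push_cast
    linarith

/-- Most pairs of points of a set that is equidistributed over `N ≥ 2` cells lie in different
cells. -/
theorem half_le_card_pairs {κ : Type*} [DecidableEq κ] (S : Finset ι) (cell : ι → κ) {N b : ℕ}
    (hN : 2 ≤ N) (himg : (S.image cell).card = N)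
    (hfib : ∀ z ∈ S.image cell, (S.filter fun q => cell q = z).card = b) :
    S.card = N * b ∧
      (S.card : ℝ) ^ 2 / 2 ≤ ((S ×ˢ S).filter fun p => cell p.1 ≠ cell p.2).card := by
  classical
  have hcard : S.card = N * b := by
    rw [Finset.card_eq_sum_card_image cell S, Finset.sum_congr rfl hfib, Finset.sum_const, himg,
      smul_eq_mul]
  refine ⟨hcard, ?_⟩
  have hsame : ((S ×ˢ S).filter fun p => cell p.1 = cell p.2).card = S.card * b := by
    rw [Finset.card_filter, Finset.sum_product]
    simp_rw [← Finset.card_filter]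
    rw [← smul_eq_mul, ← Finset.sum_const]
    refine Finset.sum_congr rfl fun q hq => ?_
    rw [← hfib (cell q) (Finset.mem_image_of_mem _ hq)]
    congr 1
    ext r
    simp [eq_comm]
  have htot := Finset.card_filter_add_card_filter_not (s := S ×ˢ S) fun p => cell p.1 = cell p.2
  rw [hsame, Finset.card_product] at htot
  have htot' : (S.card : ℝ) * b + ((S ×ˢ S).filter fun p => cell p.1 ≠ cell p.2).card =
      S.card * S.card := by exact_mod_cast htot
  have hb : (b : ℝ) * 2 ≤ S.card := by
    have : b * 2 ≤ S.card := by rw [hcard, mul_comm]; exact Nat.mul_le_mul_right _ hN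
    exact_mod_cast this
  have := mul_le_mul_of_nonneg_left hb (Nat.cast_nonneg (α := ℝ) S.card)
  nlinarith

/-- For every rich line there are a slab and a scale `2^(-A-l)` at which the density of the `l`-th
pruning near the line exceeds `Λ` although it does not at twice that scale. The points of the
line in the slab that survive the pruning still form many pairs whose distance is comparable to the
width of the slab. -/
theorem exists_crossing [Fintype ι] {κ : Type*} [DecidableEq κ] {x y : ι → ℝ}
    {A n N b : ℕ} {Λ θ a c e : ℝ} (hAn : A + 6 ≤ n) (hx : ∀ i, 0 ≤ x i ∧ x i < 1)
    (hΛ : 0 < Λ) (ha : 0 < a) (hθ : θ = 288 * n ^ 3 * Λ / a) (hc : |c| ≤ 2) {cell : ι → κ}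
    (hsep : ∀ i j, cell i ≠ cell j → scale A / 2 ≤ supDist x y i j)
    (S : Finset ι) (hS : ∀ q ∈ S, lineDist x y c e q ≤ 12 * scale n)
    (hSx : ∀ i ∈ S, ∀ j ∈ S, cell i ≠ cell j → scale (A + 3) ≤ |x i - x j|)
    (hN : 2 ≤ N) (haN : a ≤ N) (himg : (S.image cell).card = N)
    (hfib : ∀ z ∈ S.image cell, (S.filter fun q => cell q = z).card = b)
    (hlow : ((Finset.univ.filter fun q => lineDist x y c e q ≤ 5 / 4 * scale A).card : ℝ) ≤
      Λ * scale A / 4)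
    (hrich : 144 * n * (scale n * Λ) < N * b) :
    ∃ k ≤ A + 3, ∃ i < 2 ^ k, ∃ l, 1 ≤ l ∧ A + l + 4 ≤ n ∧
      Λ * scale (A + l) < ((localPruned x y A θ l k i).filter fun q =>
        lineDist x y c e q ≤ scale (A + l)).card ∧
      (((localPruned x y A θ l k i).filter fun q =>
        lineDist x y c e q ≤ 2 * scale (A + l)).card : ℝ) ≤ 2 * Λ * scale (A + l) ∧
      ((N : ℝ) * b) ^ 2 / (72 * n ^ 2) ≤
        ((localPruned x y A θ l k i ×ˢ localPruned x y A θ l k i).filter fun p =>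
          lineDist x y c e p.1 ≤ 12 * scale n ∧ lineDist x y c e p.2 ≤ 12 * scale n ∧
          scale (k + 1) ≤ |x p.1 - x p.2|).card := by
  classical
  obtain ⟨hcard, hpairs⟩ := half_le_card_pairs S cell hN himg hfib
  obtain ⟨k, hk, i, hi, hF⟩ := exists_localized_pairs S _ (Finset.filter_subset _ _) x hx (A + 3)
    (fun p hp => by
      obtain ⟨h1, h2⟩ := Finset.mem_filter.1 hp
      obtain ⟨h3, h4⟩ := Finset.mem_product.1 h1
      exact hSx _ h3 _ h4 h2) hpairs
  refine ⟨k, hk, i, hi, ?_⟩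
  have hn0 : (0 : ℝ) < n := by exact_mod_cast (by omega : 0 < n)
  have hN0 : (0 : ℝ) < N := by linarith
  have hA0 := scale_pos A
  have hθ0 : 0 < θ := by rw [hθ]; positivity
  set F := ((S ×ˢ S).filter fun p => cell p.1 ≠ cell p.2).filter fun p =>
    scale (k + 1) ≤ |x p.1 - x p.2| ∧
        (i * scale k ≤ x p.1 ∧ x p.1 < (i + 2) * scale k) ∧
        (i * scale k ≤ x p.2 ∧ x p.2 < (i + 2) * scale k) with hFdef
  have hFS : ∀ p ∈ F, p.1 ∈ S ∧ p.2 ∈ S ∧ scale (k + 1) ≤ |x p.1 - x p.2| ∧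
        (i * scale k ≤ x p.1 ∧ x p.1 < (i + 2) * scale k) ∧
        (i * scale k ≤ x p.2 ∧ x p.2 < (i + 2) * scale k) := by
    intro p hp
    simp only [hFdef, Finset.mem_filter, Finset.mem_product] at hp
    exact ⟨hp.1.1.1, hp.1.1.2, hp.2⟩
  have hF' : ((N : ℝ) * b) ^ 2 / (36 * n ^ 2) ≤ F.card := by
    refine le_trans ?_ hF
    rw [hcard]
    push_cast
    have : ((A : ℝ) + 3 + 1) ≤ n := by exact_mod_cast (by omega : A + 3 + 1 ≤ n)
    gcongr
  set cross : ℕ → Prop := fun l => Λ * scale (A + l) < ((localPruned x y A θ l k i).filter fun q =>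
        lineDist x y c e q ≤ scale (A + l)).card with hcrossdef
  -- as long as there is no crossing, half of the pairs survive
  have hsurv : ∀ l, A + l + 4 ≤ n → (∀ l' < l, ¬ cross l') →
      ((N : ℝ) * b) ^ 2 / (72 * n ^ 2) ≤
        ((localPruned x y A θ l k i ×ˢ localPruned x y A θ l k i).filter fun p =>
          lineDist x y c e p.1 ≤ 12 * scale n ∧ lineDist x y c e p.2 ≤ 12 * scale n ∧
          scale (k + 1) ≤ |x p.1 - x p.2|).card := by
    intro l hl hnc
    set S' := S.filter fun q => i * scale k ≤ x q ∧ x q < (i + 2) * scale k with hS'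
    set Z := (S'.filter fun q => q ∉ pruned x y A θ l).image cell with hZ
    have hbad : (Z.card : ℝ) * θ ≤ 2 * l * Λ :=
      card_pruned_cells_mul_le hc hθ0.le hsep S'
        (fun q hq => hS q (Finset.mem_filter.1 hq).1) (fun q hq => (Finset.mem_filter.1 hq).2) l hl
        (fun l' hl' => le_of_not_gt (hnc l' hl'))
    -- `θ` is chosen such that the pairs lost below are at most half of all pairs
    have hZcard : (Z.card : ℝ) ≤ N / (144 * n ^ 2) := by
      have h1 : (l : ℝ) ≤ n := by exact_mod_cast (by omega : l ≤ n)
      have h2 : (Z.card : ℝ) * (288 * n ^ 3 * Λ / a) ≤ 2 * n * Λ := by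
        rw [← hθ]
        refine hbad.trans ?_
        gcongr
      have h3 : (Z.card : ℝ) * (144 * n ^ 2) ≤ a := by
        have : (Z.card : ℝ) * (288 * n ^ 3 * Λ / a) =
            ((Z.card : ℝ) * (144 * n ^ 2)) * (2 * n * Λ / a) := by ring
        have h4 : 2 * n * Λ = a * (2 * n * Λ / a) := by field_simp
        replace h2 := (this.symm.le.trans h2).trans h4.le
        exact le_of_mul_le_mul_right h2 (by positivity)
      rw [le_div_iff₀ (by positivity)]
      exact h3.trans haN
    set V := S.filter fun q => cell q ∈ Z with hV
    have hVcard : V.card ≤ Z.card * b := by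
      have h1 : V.card = ∑ z ∈ V.image cell, (V.filter fun q => cell q = z).card :=
        Finset.card_eq_sum_card_image cell V
      have h2 : V.image cell ⊆ Z := by
        intro z hz
        obtain ⟨q, hq, rfl⟩ := Finset.mem_image.1 hz
        exact (Finset.mem_filter.1 hq).2
      rw [h1]
      refine (Finset.sum_le_card_nsmul _ _ b fun z hz => ?_).trans ?_
      · obtain ⟨q, hq, rfl⟩ := Finset.mem_image.1 hz
        rw [← hfib (cell q) (Finset.mem_image_of_mem _ (Finset.mem_filter.1 hq).1)]
        exact Finset.card_le_card (Finset.filter_subset_filter _ (Finset.filter_subset _ _))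
      · rw [smul_eq_mul]
        exact Nat.mul_le_mul_right _ (Finset.card_le_card h2)
    have hFsub : F ⊆ ((localPruned x y A θ l k i ×ˢ localPruned x y A θ l k i).filter fun p =>
          lineDist x y c e p.1 ≤ 12 * scale n ∧ lineDist x y c e p.2 ≤ 12 * scale n ∧
          scale (k + 1) ≤ |x p.1 - x p.2|) ∪ (V ×ˢ S ∪ S ×ˢ V) := by
      intro p hp
      obtain ⟨h1, h2, h3, h4, h5⟩ := hFS p hp
      by_cases hp1 : p.1 ∈ pruned x y A θ l
      · by_cases hp2 : p.2 ∈ pruned x y A θ l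
        · refine Finset.mem_union_left _ ?_
          simp only [Finset.mem_filter, Finset.mem_product, localPruned]
          exact ⟨⟨⟨hp1, by linarith, by linarith⟩, hp2, by linarith, by linarith⟩, hS _ h1,
            hS _ h2, h3⟩
        · refine Finset.mem_union_right _ (Finset.mem_union_right _ ?_)
          refine Finset.mem_product.2 ⟨h1, Finset.mem_filter.2 ⟨h2, ?_⟩⟩
          exact Finset.mem_image_of_mem _ (Finset.mem_filter.2
            ⟨Finset.mem_filter.2 ⟨h2, h5⟩, hp2⟩)
      · refine Finset.mem_union_right _ (Finset.mem_union_left _ ?_)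
        refine Finset.mem_product.2 ⟨Finset.mem_filter.2 ⟨h1, ?_⟩, h2⟩
        exact Finset.mem_image_of_mem _ (Finset.mem_filter.2
          ⟨Finset.mem_filter.2 ⟨h1, h4⟩, hp1⟩)
    have h1 := (Finset.card_le_card hFsub).trans ((Finset.card_union_le _ _).trans
      (Nat.add_le_add_left (Finset.card_union_le _ _) _))
    rw [Finset.card_product V S, Finset.card_product S V, hcard] at h1
    have h2 : (F.card : ℝ) ≤
        ((localPruned x y A θ l k i ×ˢ localPruned x y A θ l k i).filter fun p =>
          lineDist x y c e p.1 ≤ 12 * scale n ∧ lineDist x y c e p.2 ≤ 12 * scale n ∧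
          scale (k + 1) ≤ |x p.1 - x p.2|).card + (V.card * (N * b) + N * b * V.card) := by
      exact_mod_cast h1
    have h3 : (V.card : ℝ) ≤ N / (144 * n ^ 2) * b := by
      have : (V.card : ℝ) ≤ Z.card * b := by exact_mod_cast hVcard
      exact this.trans (mul_le_mul_of_nonneg_right hZcard (Nat.cast_nonneg _))
    have h4 : (V.card : ℝ) * (N * b) ≤ N / (144 * n ^ 2) * b * (N * b) :=
      mul_le_mul_of_nonneg_right h3 (by positivity)
    have h5 : ((N : ℝ) * b) ^ 2 / (36 * n ^ 2) =
        ((N : ℝ) * b) ^ 2 / (72 * n ^ 2) + 2 * (N / (144 * n ^ 2) * b * (N * b)) := by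
      field_simp; ring
    linarith
  have h0 : ¬ cross 0 := by
    simp only [hcrossdef, not_lt, add_zero]
    refine le_trans ?_ (hlow.trans ?_)
    · refine Nat.cast_le.2 (Finset.card_le_card fun q hq => ?_)
      have := (Finset.mem_filter.1 hq).2
      exact Finset.mem_filter.2 ⟨Finset.mem_univ _, by linarith⟩
    · have : 0 < Λ * scale A := by positivity
      linarith
  have hex : ∃ l, cross l ∧ A + l + 4 ≤ n := by
    by_contra! hcon
    obtain ⟨l, hl⟩ : ∃ l, A + l + 4 = n := ⟨n - 4 - A, by omega⟩
    have hnc : ∀ l' ≤ l, ¬ cross l' := fun l' h h' => by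
      have := hcon l' h'
      omega
    have h1 := hsurv l hl.le fun l' h => hnc l' h.le
    have h2 := le_of_not_gt (hnc l le_rfl)
    have s1 : scale (A + l) = 16 * scale n := by
      rw [← hl, scale_succ, scale_succ, scale_succ, scale_succ]; ring
    have hn := scale_pos n
    have h3 : (((localPruned x y A θ l k i ×ˢ localPruned x y A θ l k i).filter fun p =>
          lineDist x y c e p.1 ≤ 12 * scale n ∧ lineDist x y c e p.2 ≤ 12 * scale n ∧
          scale (k + 1) ≤ |x p.1 - x p.2|).card : ℝ) ≤ (((localPruned x y A θ l k i).filter fun q =>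
        lineDist x y c e q ≤ scale (A + l)).card : ℝ) ^ 2 := by
      rw [← Nat.cast_pow, Nat.cast_le, sq, ← Finset.card_product]
      refine Finset.card_le_card fun p hp => ?_
      simp only [Finset.mem_filter, Finset.mem_product] at hp ⊢
      rw [s1]
      exact ⟨⟨hp.1.1, by linarith [hp.2.1]⟩, hp.1.2, by linarith [hp.2.2.1]⟩
    have h4 : ((N : ℝ) * b) ^ 2 / (72 * n ^ 2) ≤ (Λ * (16 * scale n)) ^ 2 := by
      refine h1.trans (h3.trans ?_)
      rw [← s1]
      exact pow_le_pow_left₀ (Nat.cast_nonneg _) h2 2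
    rw [div_le_iff₀ (by positivity)] at h4
    have h5 : (144 * n * (scale n * Λ)) ^ 2 < ((N : ℝ) * b) ^ 2 :=
      pow_lt_pow_left₀ hrich (by positivity) (by norm_num)
    have h6 : 0 < (n * (scale n * Λ)) ^ 2 := by positivity
    nlinarith
  obtain ⟨hl1, hl2⟩ := Nat.find_spec hex
  set l := Nat.find hex with hl
  have hmin : ∀ l' < l, ¬ cross l' := fun l' h h' => Nat.find_min hex h ⟨h', by omega⟩
  have hlpos : 1 ≤ l := by
    rcases Nat.eq_zero_or_pos l with h | h
    · rw [h] at hl1; exact absurd hl1 h0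
    · exact h
  refine ⟨l, hlpos, hl2, hl1, ?_, hsurv l hl2 hmin⟩
  have h1 := le_of_not_gt (hmin (l - 1) (by omega))
  have s1 : scale (A + (l - 1)) = 2 * scale (A + l) := by
    rw [show A + l = A + (l - 1) + 1 by omega, scale_succ]; ring
  rw [s1] at h1
  refine le_trans ?_ (h1.trans (le_of_eq (by ring)))
  refine Nat.cast_le.2 (Finset.card_le_card ?_)
  refine Finset.filter_subset_filter _ ?_
  unfold localPruned
  refine Finset.filter_subset_filter _ ?_
  exact pruned_anti x y A θ (by omega)

/-! ### Counting rich lines -/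

/-- The lines with a common crossing scale `w = 2^(-A-l)` in a common slab. The high-frequency
count bounds the measure of the `w`-neighbourhoods of these lines, and two lines through a common
pair of points of a `w`-neighbourhood are counted by `card_lines_le`. -/
theorem card_family_mul_le [Fintype ι] {x y : ι → ℝ} {A n k i l : ℕ} {Λ θ σ : ℝ}
    (hk : k ≤ A + 3) (hl : 1 ≤ l) (hln : A + l + 4 ≤ n) (hΛ : 0 < Λ) (hσ : 0 < σ)
    (S : Finset (ℤ × ℤ)) (hc : ∀ t ∈ S, |(t.1 : ℝ) * scale n| ≤ 2)
    (h1 : ∀ t ∈ S, Λ * scale (A + l) < ((localPruned x y A θ l k i).filter fun q =>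
        lineDist x y (t.1 * scale n) (t.2 * scale n) q ≤ scale (A + l)).card)
    (h2 : ∀ t ∈ S, (((localPruned x y A θ l k i).filter fun q =>
        lineDist x y (t.1 * scale n) (t.2 * scale n) q ≤ 2 * scale (A + l)).card : ℝ) ≤
          2 * Λ * scale (A + l))
    (h3 : ∀ t ∈ S, σ ≤
        ((localPruned x y A θ l k i ×ˢ localPruned x y A θ l k i).filter fun p =>
          lineDist x y (t.1 * scale n) (t.2 * scale n) p.1 ≤ 12 * scale n ∧
          lineDist x y (t.1 * scale n) (t.2 * scale n) p.2 ≤ 12 * scale n ∧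
          scale (k + 1) ≤ |x p.1 - x p.2|).card)
    (hlow : ∀ t ∈ S, ((Finset.univ.filter fun q =>
      lineDist x y (t.1 * scale n) (t.2 * scale n) q ≤ 5 / 4 * scale A).card : ℝ) ≤
      Λ * scale A / 4) :
    S.card * σ ≤ 102400000 * ∑ p ∈ localPruned x y A θ l k i, ∑ q ∈ localPruned x y A θ l k i,
      bandKernel (2 * scale (A + l)) (scale A) (x q - x p) (y q - y p) := by
  classical
  set g := localPruned x y A θ l k i with hg
  set w := scale (A + l) with hw
  set d := scale k with hd
  set D := scale A with hD
  set δ := scale n with hδ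
  have hw0 : 0 < w := scale_pos _
  have hd0 : 0 < d := scale_pos _
  have hD0 : 0 < D := scale_pos _
  have hδ0 : 0 < δ := scale_pos _
  have hwD : w ≤ D / 2 := by
    have : scale (A + l) ≤ scale (A + 1) := scale_anti (by omega)
    rwa [scale_succ] at this
  have hDd : D ≤ 8 * d := by
    have : scale (A + 3) ≤ scale k := scale_anti hk
    rw [scale_succ, scale_succ, scale_succ, ← hD, ← hd] at this
    linarith
  have hδw : 16 * δ ≤ w := by
    have : scale n ≤ scale (A + l + 4) := scale_anti hln
    rw [scale_succ, scale_succ, scale_succ, scale_succ, ← hδ, ← hw] at this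
    linarith
  -- with the origin at the left end of the slab, the boxes of lines become axis-parallel
  set x' : ι → ℝ := fun q => x q - i * d with hx'
  set c : ℤ × ℤ → ℝ := fun t => t.1 * δ with hcdef
  set e : ℤ × ℤ → ℝ := fun t => t.2 * δ with hedef
  set e' : ℤ × ℤ → ℝ := fun t => e t + c t * (i * d) with he'
  have hx'le : ∀ q ∈ g, |x' q| ≤ 10 * d := by
    intro q hq
    have := (Finset.mem_filter.1 hq).2
    simp only [hx']
    rw [abs_le]
    constructor <;> linarith
  -- moving the line inside its box changes the distances of the points of the slab by `w / 2`
  have hmove : ∀ t, ∀ z : ℝ × ℝ, |z.1 - c t| ≤ w / (40 * d) → |z.2 - e' t| ≤ w / 4 → ∀ q ∈ g,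
      |(y q - z.1 * x' q - z.2) - (y q - c t * x q - e t)| ≤ w / 2 := by
    intro t z hz1 hz2 q hq
    have e1 : (y q - z.1 * x' q - z.2) - (y q - c t * x q - e t) =
        -((z.1 - c t) * x' q) - (z.2 - e' t) := by
      simp only [hx', he']; ring
    have e2 : |(z.1 - c t) * x' q| ≤ w / (40 * d) * (10 * d) := by
      rw [abs_mul]
      exact mul_le_mul hz1 (hx'le q hq) (abs_nonneg _) (by positivity)
    have e3 : w / (40 * d) * (10 * d) = w / 4 := by field_simp; norm_num
    rw [e3] at e2
    rw [e1]
    have a1 := abs_le.1 e2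
    have a2 := abs_le.1 hz2
    rw [abs_le]
    constructor <;> linarith
  have key := card_mul_le_energy S c e' g x' y (u := 2 * w) (v := D) (α := w / (40 * d))
    (β := w / 4) (lam := Λ / 8) (N₀ := (2 * Λ * w) ^ 2 * (10000 / d) / σ) (by positivity) hD0
    (by positivity) (by rw [div_le_one (by positivity)]; linarith) (by positivity) (by positivity)
    (by positivity) hc ?_ ?_
  · have e1 : ∀ p q, x' q - x' p = x q - x p := by intro p q; simp only [hx']; ring
    simp_rw [e1] at key
    set En := ∑ p ∈ g, ∑ q ∈ g, bandKernel (2 * w) D (x q - x p) (y q - y p) with hEn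
    have e2 : (S.card : ℝ) * (4 * (w / (40 * d)) * (w / 4)) * (Λ / 8) ^ 2 =
        (S.card * σ) * (w ^ 2 * Λ ^ 2 / (2560 * d * σ)) := by
      field_simp; ring
    have e3 : (2 * Λ * w) ^ 2 * (10000 / d) / σ * En =
        102400000 * En * (w ^ 2 * Λ ^ 2 / (2560 * d * σ)) := by
      field_simp; ring
    rw [e2, e3] at key
    exact le_of_mul_le_mul_right key (by positivity)
  · intro t ht z hz1 hz2
    have hm := hmove t z hz1 hz2
    unfold bandIncidence
    rw [Finset.sum_sub_distrib]
    have hhigh : Λ / 4 ≤ ∑ q ∈ g, bump (2 * w) (y q - z.1 * x' q - z.2) := by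
      have b1 : ∑ q ∈ g.filter (fun q => lineDist x y (c t) (e t) q ≤ w), (2 * (2 * w))⁻¹ ≤
          ∑ q ∈ g, bump (2 * w) (y q - z.1 * x' q - z.2) := by
        rw [Finset.sum_filter]
        refine Finset.sum_le_sum fun q hq => ?_
        split_ifs with h
        · rw [bump_of_le]
          have a1 := abs_le.1 (hm q hq)
          have a2 := abs_le.1 (show |y q - c t * x q - e t| ≤ w from h)
          rw [abs_le]
          constructor <;> linarith
        · exact bump_nonneg (by positivity) _
      refine le_trans ?_ b1
      rw [Finset.sum_const, nsmul_eq_mul]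
      have b2 := (h1 t ht).le
      calc Λ / 4 = (Λ * w) * (2 * (2 * w))⁻¹ := by field_simp; norm_num
        _ ≤ _ := mul_le_mul_of_nonneg_right b2 (by positivity)
    have hlow' : ∑ q ∈ g, bump D (y q - z.1 * x' q - z.2) ≤ Λ / 8 := by
      have b1 : ∑ q ∈ g, bump D (y q - z.1 * x' q - z.2) ≤
          ∑ q ∈ g.filter (fun q => lineDist x y (c t) (e t) q ≤ 5 / 4 * D), (2 * D)⁻¹ := by
        rw [Finset.sum_filter]
        refine Finset.sum_le_sum fun q hq => ?_
        split_ifs with h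
        · exact bump_le hD0 _
        · rw [bump_of_lt]
          by_contra hcon
          refine h ?_
          have a1 := abs_le.1 (hm q hq)
          have a2 := abs_le.1 (le_of_not_gt hcon)
          unfold lineDist
          rw [abs_le]
          constructor <;> linarith
      refine b1.trans ?_
      rw [Finset.sum_const, nsmul_eq_mul]
      have b2 : ((g.filter fun q => lineDist x y (c t) (e t) q ≤ 5 / 4 * D).card : ℝ) ≤
          Λ * D / 4 := by
        refine le_trans ?_ (hlow t ht)
        exact_mod_cast Finset.card_le_card
          (Finset.filter_subset_filter _ (Finset.subset_univ _))
      calc _ ≤ (Λ * D / 4) * (2 * D)⁻¹ := mul_le_mul_of_nonneg_right b2 (by positivity)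
        _ = Λ / 8 := by field_simp; norm_num
    linarith
  · intro z
    set Sz := S.filter fun t => |z.1 - c t| ≤ w / (40 * d) ∧ |z.2 - e' t| ≤ w / 4 with hSz
    rcases Sz.eq_empty_or_nonempty with h0 | ⟨t₀, ht₀⟩
    · rw [h0]; simp; positivity
    have ht₀' := Finset.mem_filter.1 ht₀
    set g₀ := g.filter fun q => lineDist x y (c t₀) (e t₀) q ≤ 2 * w with hg₀
    set P₀ := (g₀ ×ˢ g₀).filter fun p => scale (k + 1) ≤ |x p.1 - x p.2| with hP₀
    set r : ℤ × ℤ → ι × ι → Prop := fun t p =>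
      lineDist x y (c t) (e t) p.1 ≤ 12 * δ ∧ lineDist x y (c t) (e t) p.2 ≤ 12 * δ with hr
    have hlower : ∀ t ∈ Sz, σ ≤ (P₀.bipartiteAbove r t).card := by
      intro t ht
      have ht' := Finset.mem_filter.1 ht
      refine (h3 t ht'.1).trans ?_
      refine Nat.cast_le.2 (Finset.card_le_card fun p hp => ?_)
      obtain ⟨hp1, hp2, hp3, hp4⟩ := Finset.mem_filter.1 hp
      have hp1 := Finset.mem_product.1 hp1
      have hnear : ∀ q ∈ g, lineDist x y (c t) (e t) q ≤ 12 * δ → q ∈ g₀ := by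
        intro q hq hqt
        refine Finset.mem_filter.2 ⟨hq, ?_⟩
        have a1 := abs_le.1 (hmove t z ht'.2.1 ht'.2.2 q hq)
        have a2 := abs_le.1 (hmove t₀ z ht₀'.2.1 ht₀'.2.2 q hq)
        have a3 := abs_le.1 (show |y q - c t * x q - e t| ≤ 12 * δ from hqt)
        unfold lineDist
        rw [abs_le]
        constructor <;> linarith
      rw [Finset.mem_bipartiteAbove]
      exact ⟨Finset.mem_filter.2 ⟨Finset.mem_product.2
        ⟨hnear _ hp1.1 hp2, hnear _ hp1.2 hp3⟩, hp4⟩, hp2, hp3⟩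
    have hupper : ∀ p ∈ P₀, ((Sz.bipartiteBelow r p).card : ℝ) ≤ 10000 / d := by
      intro p hp
      have hp4 := (Finset.mem_filter.1 hp).2
      rw [scale_succ] at hp4
      refine card_lines_le (Sz.bipartiteBelow r p) hδ0 hd0 (scale_le_one k) hp4
        (y := y p.1) (y' := y p.2) ?_ ?_
      · intro t ht
        exact (Finset.mem_bipartiteBelow r |>.1 ht).2.1
      · intro t ht
        exact (Finset.mem_bipartiteBelow r |>.1 ht).2.2
    have hdouble := Finset.sum_card_bipartiteAbove_eq_sum_card_bipartiteBelow (s := Sz) (t := P₀) r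
    have b1 : (Sz.card : ℝ) * σ ≤ ∑ t ∈ Sz, ((P₀.bipartiteAbove r t).card : ℝ) := by
      rw [← nsmul_eq_mul]
      exact Finset.card_nsmul_le_sum _ _ _ hlower
    have b2 : ∑ p ∈ P₀, ((Sz.bipartiteBelow r p).card : ℝ) ≤ P₀.card * (10000 / d) := by
      rw [← nsmul_eq_mul]
      exact Finset.sum_le_card_nsmul _ _ _ hupper
    have b3 : ∑ t ∈ Sz, ((P₀.bipartiteAbove r t).card : ℝ) =
        ∑ p ∈ P₀, ((Sz.bipartiteBelow r p).card : ℝ) := by exact_mod_cast hdouble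
    have b4 : (P₀.card : ℝ) ≤ (2 * Λ * w) ^ 2 := by
      have c1 : P₀.card ≤ g₀.card * g₀.card := by
        rw [← Finset.card_product]
        exact Finset.card_le_card (Finset.filter_subset _ _)
      have c2 : (P₀.card : ℝ) ≤ g₀.card * g₀.card := by exact_mod_cast c1
      have c3 := h2 t₀ ht₀'.1
      refine c2.trans ?_
      rw [sq]
      exact mul_le_mul c3 c3 (Nat.cast_nonneg _) (by positivity)
    rw [le_div_iff₀ hσ]
    refine (b1.trans (b3.le.trans b2)).trans ?_
    exact mul_le_mul_of_nonneg_right b4 (by positivity)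

/-- The slabs overlap boundedly. -/
theorem sum_card_localPruned_le [Fintype ι] {x y : ι → ℝ} {A k l : ℕ} {θ : ℝ} (hk : k ≤ A + 3) :
    ∑ i ∈ Finset.range (2 ^ k), ((localPruned x y A θ l k i).card : ℝ) ≤ 19 * Fintype.card ι := by
  classical
  have hd0 := scale_pos k
  have hDd : scale A ≤ 8 * scale k := by
    have : scale (A + 3) ≤ scale k := scale_anti hk
    rw [scale_succ, scale_succ, scale_succ] at this
    linarith
  have h1 : ∀ i, ((localPruned x y A θ l k i).card : ℝ) ≤ ∑ q : ι,
      if i * scale k - scale A ≤ x q ∧ x q ≤ (i + 2) * scale k + scale A then (1 : ℝ) else 0 := by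
    intro i
    rw [← Finset.sum_filter, Finset.sum_const, nsmul_eq_mul, mul_one]
    exact Nat.cast_le.2 (Finset.card_le_card
      (Finset.filter_subset_filter _ (Finset.subset_univ _)))
  refine (Finset.sum_le_sum fun i _ => h1 i).trans ?_
  rw [Finset.sum_comm]
  have h2 : ∀ q : ι, (∑ i ∈ Finset.range (2 ^ k),
      if i * scale k - scale A ≤ x q ∧ x q ≤ (i + 2) * scale k + scale A then (1 : ℝ) else 0) ≤
        19 := by
    intro q
    rw [← Finset.sum_filter, Finset.sum_const, nsmul_eq_mul, mul_one]
    set s := (Finset.range (2 ^ k)).filter fun i : ℕ =>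
      i * scale k - scale A ≤ x q ∧ x q ≤ (i + 2) * scale k + scale A with hs
    rcases s.eq_empty_or_nonempty with h0 | h0
    · rw [h0]; norm_num
    set m := s.min' h0 with hm
    have hsub : s ⊆ Finset.Icc m (m + 18) := by
      intro i hi
      rw [Finset.mem_Icc]
      refine ⟨Finset.min'_le _ _ hi, ?_⟩
      have a1 := (Finset.mem_filter.1 hi).2
      have a2 := (Finset.mem_filter.1 (Finset.min'_mem s h0)).2
      have a3 : (i : ℝ) * scale k ≤ (m + 18) * scale k := by
        have : x q ≤ ((m : ℝ) + 2) * scale k + scale A := a2.2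
        linarith
      have := le_of_mul_le_mul_right a3 hd0
      exact_mod_cast this
    have := Finset.card_le_card hsub
    rw [Nat.card_Icc] at this
    have h3 : s.card ≤ 19 := by omega
    exact_mod_cast h3
  refine (Finset.sum_le_sum fun q _ => h2 q).trans (le_of_eq ?_)
  rw [Finset.sum_const, nsmul_eq_mul, Finset.card_univ, mul_comm]

/-- The bound for the number of rich lines, for a set of points with separated cells. -/
theorem card_rich_lines_mul_le [Fintype ι] {x y : ι → ℝ} {A n N b : ℕ} {Λ a B : ℝ}
    (hAn : A + 6 ≤ n) (hx : ∀ i, 0 ≤ x i ∧ x i < 1) (hy : ∀ i, 0 ≤ y i ∧ y i < 1) (hΛ : 0 < Λ)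
    (ha : 0 < a) (hN : 2 ≤ N) (haN : a ≤ N) (cell : ι → ℤ × ℤ)
    (hcell : ∀ i, cell i = (⌊x i / scale A⌋, ⌊y i / scale A⌋)) (hB0 : 0 ≤ B)
    (hB : ∀ i, ((Finset.univ.filter fun j => cell j = cell i).card : ℝ) ≤ B)
    (hsep : ∀ i j, cell i ≠ cell j → scale A / 2 ≤ supDist x y i j)
    (hrich : 144 * n * (scale n * Λ) < N * b)
    (𝒯 : Finset (ℤ × ℤ)) (hc : ∀ t ∈ 𝒯, |(t.1 : ℝ) * scale n| ≤ 2)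
    (hlow : ∀ t ∈ 𝒯, ((Finset.univ.filter fun q =>
      lineDist x y (t.1 * scale n) (t.2 * scale n) q ≤ 5 / 4 * scale A).card : ℝ) ≤
      Λ * scale A / 4)
    (hS : ∀ t ∈ 𝒯, ∃ S : Finset ι,
      (∀ q ∈ S, lineDist x y (t.1 * scale n) (t.2 * scale n) q ≤ 12 * scale n) ∧
      (∀ i ∈ S, ∀ j ∈ S, cell i ≠ cell j → scale (A + 3) ≤ |x i - x j|) ∧
      (S.image cell).card = N ∧ ∀ z ∈ S.image cell, (S.filter fun q => cell q = z).card = b) :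
    𝒯.card * ((N : ℝ) * b) ^ 2 ≤ 72 * n ^ 5 * (102400000 * (19 * Fintype.card ι) *
      (144 * (288 * n ^ 3 * Λ / a) + 401408 * (B / scale A))) := by
  classical
  set θ := 288 * n ^ 3 * Λ / a with hθ
  have hn0 : (0 : ℝ) < n := by exact_mod_cast (by omega : 0 < n)
  have hθ0 : 0 < θ := by rw [hθ]; positivity
  have hδ0 := scale_pos n
  have hA0 := scale_pos A
  have hNb : 0 < (N : ℝ) * b := lt_of_le_of_lt (by positivity) hrich
  set σ := ((N : ℝ) * b) ^ 2 / (72 * n ^ 2) with hσ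
  have hσ0 : 0 < σ := by positivity
  set good : ℕ → ℕ → ℕ → ℤ × ℤ → Prop := fun k i l t => 1 ≤ l ∧ A + l + 4 ≤ n ∧
      Λ * scale (A + l) < ((localPruned x y A θ l k i).filter fun q =>
        lineDist x y (t.1 * scale n) (t.2 * scale n) q ≤ scale (A + l)).card ∧
      (((localPruned x y A θ l k i).filter fun q =>
        lineDist x y (t.1 * scale n) (t.2 * scale n) q ≤ 2 * scale (A + l)).card : ℝ) ≤
          2 * Λ * scale (A + l) ∧
      σ ≤ ((localPruned x y A θ l k i ×ˢ localPruned x y A θ l k i).filter fun p =>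
          lineDist x y (t.1 * scale n) (t.2 * scale n) p.1 ≤ 12 * scale n ∧
          lineDist x y (t.1 * scale n) (t.2 * scale n) p.2 ≤ 12 * scale n ∧
          scale (k + 1) ≤ |x p.1 - x p.2|).card with hgood
  set E := (n : ℝ) * (144 * θ + 401408 * (B / scale A)) with hE
  have hE0 : 0 ≤ E := by positivity
  have hcover : 𝒯 ⊆ (Finset.range n).biUnion fun l => (Finset.range (A + 4)).biUnion fun k =>
      (Finset.range (2 ^ k)).biUnion fun i => 𝒯.filter (good k i l) := by
    intro t ht
    obtain ⟨S, hS1, hS2, hS3, hS4⟩ := hS t ht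
    obtain ⟨k, hk, i, hi, l, hl, hln, hrest⟩ := exists_crossing hAn hx hΛ ha hθ (hc t ht) hsep S
      hS1 hS2 hN haN hS3 hS4 (hlow t ht) hrich
    simp only [Finset.mem_biUnion, Finset.mem_range, Finset.mem_filter]
    exact ⟨l, by omega, k, by omega, i, hi, ht, hl, hln, hrest⟩
  have hfam : ∀ l k i, k ≤ A + 3 → ((𝒯.filter (good k i l)).card : ℝ) * σ ≤
      102400000 * ((localPruned x y A θ l k i).card * E) := by
    intro l k i hk
    rcases (𝒯.filter (good k i l)).eq_empty_or_nonempty with h0 | ⟨t₀, ht₀⟩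
    · rw [h0]; simp; positivity
    obtain ⟨-, hl, hln, -⟩ := Finset.mem_filter.1 ht₀
    have h1 := card_family_mul_le hk hl hln hΛ hσ0 (𝒯.filter (good k i l))
      (fun t ht => hc t (Finset.mem_filter.1 ht).1)
      (fun t ht => (Finset.mem_filter.1 ht).2.2.2.1)
      (fun t ht => (Finset.mem_filter.1 ht).2.2.2.2.1)
      (fun t ht => (Finset.mem_filter.1 ht).2.2.2.2.2)
      (fun t ht => hlow t (Finset.mem_filter.1 ht).1)
    refine h1.trans (mul_le_mul_of_nonneg_left ?_ (by norm_num))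
    have h2 := energy_pruned_le (x := x) (y := y) (g := localPruned x y A θ l k i) hl hθ0.le hB0
      cell hcell hB (fun i j => by
        have a1 := hx i
        have a2 := hx j
        have a3 := hy i
        have a4 := hy j
        unfold supDist
        refine max_le ?_ ?_ <;> rw [abs_le] <;> constructor <;> linarith)
      (Finset.filter_subset _ _)
    refine h2.trans (mul_le_mul_of_nonneg_left ?_ (Nat.cast_nonneg _))
    refine mul_le_mul_of_nonneg_right ?_ (by positivity)
    exact_mod_cast (by omega : A + l + 3 ≤ n)
  have hcount : (𝒯.card : ℝ) * σ ≤ n * (n * (102400000 * ((19 * Fintype.card ι) * E))) := by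
    have h1 : (𝒯.card : ℝ) ≤ ∑ l ∈ Finset.range n, ∑ k ∈ Finset.range (A + 4),
        ∑ i ∈ Finset.range (2 ^ k), ((𝒯.filter (good k i l)).card : ℝ) := by
      have := (Finset.card_le_card hcover).trans (Finset.card_biUnion_le.trans
        (Finset.sum_le_sum fun l _ => Finset.card_biUnion_le.trans
          (Finset.sum_le_sum fun k _ => Finset.card_biUnion_le)))
      exact_mod_cast this
    have h2 := mul_le_mul_of_nonneg_right h1 hσ0.le
    refine h2.trans ?_
    simp_rw [Finset.sum_mul]
    have h3 : ∀ l ∈ Finset.range n, ∑ k ∈ Finset.range (A + 4),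
        ∑ i ∈ Finset.range (2 ^ k), ((𝒯.filter (good k i l)).card : ℝ) * σ ≤
        n * (102400000 * ((19 * Fintype.card ι) * E)) := by
      intro l _
      have h4 : ∀ k ∈ Finset.range (A + 4), ∑ i ∈ Finset.range (2 ^ k),
          ((𝒯.filter (good k i l)).card : ℝ) * σ ≤ 102400000 * ((19 * Fintype.card ι) * E) := by
        intro k hk
        have hk' : k ≤ A + 3 := Nat.lt_succ_iff.1 (Finset.mem_range.1 hk)
        refine (Finset.sum_le_sum fun i _ => hfam l k i hk').trans ?_
        rw [← Finset.mul_sum, ← Finset.sum_mul]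
        refine mul_le_mul_of_nonneg_left ?_ (by norm_num)
        exact mul_le_mul_of_nonneg_right (sum_card_localPruned_le hk') hE0
      refine (Finset.sum_le_card_nsmul _ _ _ h4).trans ?_
      rw [Finset.card_range, nsmul_eq_mul]
      refine mul_le_mul_of_nonneg_right ?_ (by positivity)
      exact_mod_cast (by omega : A + 4 ≤ n)
    refine (Finset.sum_le_card_nsmul _ _ _ h3).trans (le_of_eq ?_)
    rw [Finset.card_range, nsmul_eq_mul]
  have e1 : (𝒯.card : ℝ) * ((N : ℝ) * b) ^ 2 = 72 * n ^ 2 * (𝒯.card * σ) := by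
    rw [hσ]; field_simp
  rw [e1]
  refine (mul_le_mul_of_nonneg_left hcount (by positivity)).trans (le_of_eq ?_)
  rw [hE]
  ring

/-! ### From dyadic cubes and tubes to points and lines -/

theorem exists_eq_map_univ (P : Multiset (ℤ × ℤ)) :
    ∃ (M : ℕ) (f : Fin M → ℤ × ℤ), P = Finset.univ.val.map f := by
  induction P using Quotient.inductionOn with
  | h l => exact ⟨l.length, l.get, by rw [Fin.univ_val_map, List.ofFn_get]; rfl⟩

/-- The first coordinate of the lower left corner of the cube with index `f i`. -/
noncomputable def cornerX (n : ℕ) (f : ι → ℤ × ℤ) (i : ι) : ℝ := (f i).1 * scale n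

/-- The second coordinate of the lower left corner of the cube with index `f i`. -/
noncomputable def cornerY (n : ℕ) (f : ι → ℤ × ℤ) (i : ι) : ℝ := (f i).2 * scale n

theorem corner_bounds {n : ℕ} {f : ι → ℤ × ℤ} (hf : ∀ i, cube n (f i) ⊆ unitSquare) (i : ι) :
    (0 ≤ cornerX n f i ∧ cornerX n f i < 1) ∧ 0 ≤ cornerY n f i ∧ cornerY n f i < 1 := by
  have h := hf i (corner_mem_cube n (f i))
  simp only [unitSquare, Set.mem_ofPred_eq] at h
  simpa [cornerX, cornerY, and_assoc] using h

theorem ancestor_eq_floor {n A : ℕ} (hA : A ≤ n) (f : ι → ℤ × ℤ) (i : ι) :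
    ancestor n A (f i) = (⌊cornerX n f i / scale A⌋, ⌊cornerY n f i / scale A⌋) := by
  have h := (mem_cube_iff _ _ _).1 (cube_subset_cube_ancestor hA (f i) (corner_mem_cube n (f i)))
  refine Prod.ext ?_ ?_
  · simpa [cornerX] using h.1.symm
  · simpa [cornerY] using h.2.symm

open Classical in
theorem cubeCount_map [Fintype ι] (n : ℕ) (f : ι → ℤ × ℤ) (U : Set Plane) :
    cubeCount n (Finset.univ.val.map f) U =
      (Finset.univ.filter fun i => cube n (f i) ⊆ U).card := by
  unfold cubeCount
  rw [Multiset.countP_map]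
  rfl

theorem coverCubes_map [Fintype ι] {n A : ℕ} (hA : A ≤ n) (f : ι → ℤ × ℤ) :
    coverCubes n A (Finset.univ.val.map f) =
      ((Finset.univ.image fun i => ancestor n A (f i) : Finset (ℤ × ℤ)) : Set (ℤ × ℤ)) := by
  rw [coverCubes_eq hA]
  ext Q
  simp

theorem dist_sq_eq (p q : Plane) : dist p q ^ 2 = (p 0 - q 0) ^ 2 + (p 1 - q 1) ^ 2 := by
  rw [EuclideanSpace.dist_eq, Real.sq_sqrt (by positivity), Fin.sum_univ_two, Real.dist_eq,
    Real.dist_eq, sq_abs, sq_abs]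

theorem abs_sub_le_dist (p q : Plane) : |p 0 - q 0| ≤ dist p q ∧ |p 1 - q 1| ≤ dist p q := by
  have h := dist_sq_eq p q
  constructor
  · refine abs_le_of_sq_le_sq ?_ dist_nonneg
    nlinarith [sq_nonneg (p 1 - q 1)]
  · refine abs_le_of_sq_le_sq ?_ dist_nonneg
    nlinarith [sq_nonneg (p 0 - q 0)]

theorem corner_sep {n A : ℕ} (hA : A ≤ n) {f : ι → ℤ × ℤ}
    (hsep : ∀ i j, ancestor n A (f i) ≠ ancestor n A (f j) →
      ∀ p ∈ cube A (ancestor n A (f i)), ∀ q ∈ cube A (ancestor n A (f j)), scale A ≤ dist p q)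
    {i j : ι} (hij : ancestor n A (f i) ≠ ancestor n A (f j)) :
    scale A ^ 2 ≤ (cornerX n f i - cornerX n f j) ^ 2 + (cornerY n f i - cornerY n f j) ^ 2 := by
  have h := hsep i j hij _ (cube_subset_cube_ancestor hA _ (corner_mem_cube n (f i))) _
    (cube_subset_cube_ancestor hA _ (corner_mem_cube n (f j)))
  have h2 := pow_le_pow_left₀ (scale_pos A).le h 2
  rw [dist_sq_eq] at h2
  simpa [cornerX, cornerY] using h2

theorem half_scale_le_supDist {x y : ι → ℝ} {i j : ι} {D : ℝ}
    (h : D ^ 2 ≤ (x i - x j) ^ 2 + (y i - y j) ^ 2) : D / 2 ≤ supDist x y i j := by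
  have h1 : |x j - x i| ≤ supDist x y i j := le_max_left _ _
  have h2 : |y j - y i| ≤ supDist x y i j := le_max_right _ _
  have h0 := (abs_nonneg _).trans h1
  have h3 : (x i - x j) ^ 2 ≤ supDist x y i j ^ 2 := by
    rw [abs_sub_comm] at h1; exact sq_le_sq' (by linarith [abs_le.1 h1]) (abs_le.1 h1).2
  have h4 : (y i - y j) ^ 2 ≤ supDist x y i j ^ 2 := by
    rw [abs_sub_comm] at h2; exact sq_le_sq' (by linarith [abs_le.1 h2]) (abs_le.1 h2).2
  by_contra hcon
  have : supDist x y i j ^ 2 < (D / 2) ^ 2 := pow_lt_pow_left₀ (lt_of_not_ge hcon) h0 (by norm_num)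
  nlinarith

/-- Points of different cells near one line are separated horizontally, because the slope is
bounded: at nearly equal abscissae the ordinates would differ by less than `D` as well. -/
theorem horizontal_sep {x y : ι → ℝ} {i j : ι} {D δ c e : ℝ} (hD : 0 < D) (hδD : 64 * δ ≤ D)
    (hc : |c| ≤ 2) (hi : lineDist x y c e i ≤ 12 * δ) (hj : lineDist x y c e j ≤ 12 * δ)
    (h : D ^ 2 ≤ (x i - x j) ^ 2 + (y i - y j) ^ 2) : D / 8 ≤ |x i - x j| := by
  by_contra hcon
  have hX := lt_of_not_ge hcon
  have hX' := abs_lt.1 hX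
  have hcX : |c * (x i - x j)| ≤ 2 * (D / 8) := by
    rw [abs_mul]
    exact mul_le_mul hc hX.le (abs_nonneg _) (by norm_num)
  have a1 := abs_le.1 hi
  have a2 := abs_le.1 hj
  have a3 := abs_le.1 hcX
  have hY1 : y i - y j ≤ 5 / 8 * D := by linarith
  have hY2 : -(5 / 8 * D) ≤ y i - y j := by linarith
  have b1 : (y i - y j) ^ 2 ≤ (5 / 8 * D) ^ 2 := sq_le_sq' hY2 hY1
  have b2 : (x i - x j) ^ 2 ≤ (D / 8) ^ 2 := sq_le_sq' hX'.1.le hX'.2.le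
  nlinarith [sq_pos_of_pos hD]

theorem slope_le_of_mem_tubeIndices {n : ℕ} {t : ℤ × ℤ} (ht : t ∈ tubeIndices n) :
    |(t.1 : ℝ) * scale n| ≤ 1 + scale n := by
  obtain ⟨c, ⟨h1, h2, -, -⟩, h3, h4⟩ := ht
  have := scale_pos n
  rw [abs_le]
  constructor <;> linarith

theorem lineDist_le_of_subset_fatTube {n : ℕ} {f : ι → ℤ × ℤ} {t : ℤ × ℤ} {i : ι}
    (hn : scale n ≤ 1 / 64) (hf : cube n (f i) ⊆ unitSquare) (ht : t ∈ tubeIndices n)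
    (h : cube n (f i) ⊆ fatTube 4 n t) :
    lineDist (cornerX n f) (cornerY n f) (t.1 * scale n) (t.2 * scale n) i ≤ 12 * scale n := by
  have hδ := scale_pos n
  have hp := h (corner_mem_cube n (f i))
  have hu := hf (corner_mem_cube n (f i))
  set p : Plane := !₂[((f i).1 : ℝ) * scale n, ((f i).2 : ℝ) * scale n] with hpdef
  have hp0 : p 0 = cornerX n f i := by simp [hpdef, cornerX]
  have hp1 : p 1 = cornerY n f i := by simp [hpdef, cornerY]
  have hp' : p ∈ Metric.thickening (9 / 2 * scale n) (tube n t) :=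
    Metric.cthickening_subset_thickening' (by positivity) (by linarith) _ hp
  obtain ⟨z, hz, hd⟩ := Metric.mem_thickening_iff.1 hp'
  obtain ⟨c, hc, hcz⟩ := Set.mem_iUnion₂.1 hz
  obtain ⟨c1, c2, c3, c4⟩ := hc
  have hcz : z 1 = c 0 * z 0 + c 1 := hcz
  obtain ⟨d1, d2⟩ := abs_sub_le_dist p z
  have e1 := abs_le.1 (d1.trans hd.le)
  have e2 := abs_le.1 (d2.trans hd.le)
  have hs := slope_le_of_mem_tubeIndices ht
  have hslope : |(t.1 : ℝ) * scale n| ≤ 65 / 64 := by linarith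
  rw [hp0] at e1
  rw [hp1] at e2
  simp only [unitSquare, Set.mem_ofPred_eq, hp0, hp1] at hu
  have hz0 : |z 0| ≤ 5 / 4 := by rw [abs_le]; constructor <;> linarith
  have f1 : |(c 0 - t.1 * scale n) * z 0| ≤ scale n * (5 / 4) := by
    rw [abs_mul]
    refine mul_le_mul ?_ hz0 (abs_nonneg _) hδ.le
    rw [abs_le]; constructor <;> linarith
  have f2 : |(t.1 : ℝ) * scale n * (cornerX n f i - z 0)| ≤ 65 / 64 * (9 / 2 * scale n) := by
    rw [abs_mul]
    refine mul_le_mul hslope ?_ (abs_nonneg _) (by norm_num)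
    rw [abs_le]; exact e1
  have g1 := abs_le.1 f1
  have g2 := abs_le.1 f2
  unfold lineDist
  have key : cornerY n f i - t.1 * scale n * cornerX n f i - t.2 * scale n =
      (cornerY n f i - z 1) - t.1 * scale n * (cornerX n f i - z 0)
      + (c 0 - t.1 * scale n) * z 0 + (c 1 - t.2 * scale n) := by
    rw [hcz]; ring
  rw [key, abs_le]
  constructor <;> linarith

theorem cube_subset_fatTube_of_lineDist_le {n A : ℕ} (hA : A ≤ n) {f : ι → ℤ × ℤ} {t : ℤ × ℤ}
    {i : ι} (hs : |(t.1 : ℝ) * scale n| ≤ 2)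
    (h : lineDist (cornerX n f) (cornerY n f) (t.1 * scale n) (t.2 * scale n) i ≤
      5 / 4 * scale A) :
    cube A (ancestor n A (f i)) ⊆ fatTube 6 A (ancestor n A t) := by
  intro z hz
  have hD := scale_pos A
  have hc := cube_subset_cube_ancestor hA _ (corner_mem_cube n (f i))
  obtain ⟨a1, a2, a3, a4⟩ := hz
  obtain ⟨b1, b2, b3, b4⟩ := hc
  simp only [Matrix.cons_val_zero, Matrix.cons_val_one] at b1 b2 b3 b4
  change _ ≤ cornerX n f i at b1
  change cornerX n f i < _ at b2
  change _ ≤ cornerY n f i at b3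
  change cornerY n f i < _ at b4
  set w : Plane := !₂[z 0, t.1 * scale n * z 0 + t.2 * scale n] with hw
  have hw0 : w 0 = z 0 := by simp [hw]
  have hw1 : w 1 = t.1 * scale n * z 0 + t.2 * scale n := by simp [hw]
  have hwt : w ∈ tube A (ancestor n A t) := by
    refine Set.mem_biUnion (cube_subset_cube_ancestor hA t (corner_mem_cube n t)) ?_
    simp only [dualLine, Set.mem_ofPred_eq, hw0, hw1]
    simp
  refine Metric.mem_cthickening_of_dist_le z w _ _ hwt ?_
  refine abs_le_of_sq_le_sq' ?_ (by positivity) |>.2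
  rw [dist_sq_eq, hw0, hw1, sub_self]
  have hx : |t.1 * scale n * (cornerX n f i - z 0)| ≤ 2 * scale A := by
    rw [abs_mul]
    refine mul_le_mul hs ?_ (abs_nonneg _) (by norm_num)
    rw [abs_le]; constructor <;> linarith
  have g1 := abs_le.1 hx
  have g2 := abs_le.1 h
  have key : |z 1 - (t.1 * scale n * z 0 + t.2 * scale n)| ≤ 6 * scale A := by
    rw [abs_le]; constructor <;> linarith
  have := sq_le_sq' (abs_le.1 key).1 (abs_le.1 key).2
  linarith

/-- Choosing exactly `b` points in each cell of `R`. -/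
theorem exists_equidistributed_subset {κ : Type*} [DecidableEq κ] (R : Finset κ)
    (U : κ → Finset ι) (cell : ι → κ) {b : ℕ} (hb : 1 ≤ b) (hU : ∀ Q ∈ R, ∀ i ∈ U Q, cell i = Q)
    (hcard : ∀ Q ∈ R, b ≤ (U Q).card) :
    ∃ S : Finset ι, (∀ i ∈ S, cell i ∈ R ∧ i ∈ U (cell i)) ∧ S.image cell = R ∧
      ∀ z ∈ S.image cell, (S.filter fun q => cell q = z).card = b := by
  classical
  have hex : ∀ Q, ∃ V : Finset ι, Q ∈ R → V ⊆ U Q ∧ V.card = b := by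
    intro Q
    by_cases hQ : Q ∈ R
    · obtain ⟨V, h1, h2⟩ := Finset.exists_subset_card_eq (hcard Q hQ)
      exact ⟨V, fun _ => ⟨h1, h2⟩⟩
    · exact ⟨∅, fun h => absurd h hQ⟩
  choose V hV using hex
  have hmem : ∀ i, i ∈ R.biUnion V ↔ cell i ∈ R ∧ i ∈ V (cell i) := by
    intro i
    rw [Finset.mem_biUnion]
    constructor
    · rintro ⟨Q, hQ, hi⟩
      have := hU Q hQ i ((hV Q hQ).1 hi)
      rw [this]; exact ⟨hQ, hi⟩
    · rintro ⟨h1, h2⟩; exact ⟨_, h1, h2⟩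
  have himg : (R.biUnion V).image cell = R := by
    ext Q
    rw [Finset.mem_image]
    constructor
    · rintro ⟨i, hi, rfl⟩; exact ((hmem i).1 hi).1
    · intro hQ
      have : (V Q).Nonempty := by rw [← Finset.card_pos, (hV Q hQ).2]; omega
      obtain ⟨i, hi⟩ := this
      exact ⟨i, Finset.mem_biUnion.2 ⟨Q, hQ, hi⟩, hU Q hQ i ((hV Q hQ).1 hi)⟩
  refine ⟨R.biUnion V, fun i hi => ?_, himg, fun z hz => ?_⟩
  · obtain ⟨h1, h2⟩ := (hmem i).1 hi
    exact ⟨h1, (hV _ h1).1 h2⟩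
  · rw [himg] at hz
    rw [← (hV z hz).2]
    congr 1
    ext i
    rw [Finset.mem_filter, hmem]
    constructor
    · rintro ⟨⟨-, h2⟩, rfl⟩; exact h2
    · intro hi
      have := hU z hz i ((hV z hz).1 hi)
      rw [this]; exact ⟨⟨hz, hi⟩, rfl⟩

/-! ### Rich tubes and their points -/

/-- Uniformity bounds the number of points in a cell by a multiple of the average. -/
theorem card_cell_le [Fintype ι] {n A : ℕ} (hA : A ≤ n) {f : ι → ℤ × ℤ} {K : ℝ}
    (huni : ∀ Q ∈ coverCubes n A (Finset.univ.val.map f),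
      ∀ Q' ∈ coverCubes n A (Finset.univ.val.map f),
      (cubeCount n (Finset.univ.val.map f) (cube A Q) : ℝ) ≤
        K * cubeCount n (Finset.univ.val.map f) (cube A Q')) (i : ι) :
    ((Finset.univ.filter fun j => ancestor n A (f j) = ancestor n A (f i)).card : ℝ) ≤
      K * Fintype.card ι / (coverCubes n A (Finset.univ.val.map f)).ncard := by
  classical
  set C := Finset.univ.image fun i => ancestor n A (f i) with hC
  have hcov : coverCubes n A (Finset.univ.val.map f) = (C : Set (ℤ × ℤ)) := coverCubes_map hA f
  have hcc : ∀ Q, cubeCount n (Finset.univ.val.map f) (cube A Q) =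
      (Finset.univ.filter fun j => ancestor n A (f j) = Q).card := by
    intro Q
    rw [cubeCount_map]
    congr 1
    ext j
    simp only [Finset.mem_filter, Finset.mem_univ, true_and]
    rw [cube_subset_iff hA, eq_comm]
  have hmem : ∀ j, ancestor n A (f j) ∈ C := fun j => Finset.mem_image_of_mem _ (Finset.mem_univ j)
  have hCpos : 0 < C.card := Finset.card_pos.2 ⟨_, hmem i⟩
  rw [hcov, Set.ncard_coe_finset, le_div_iff₀ (by exact_mod_cast hCpos)]
  have hsum : (Fintype.card ι : ℝ) =
      ∑ Q ∈ C, ((Finset.univ.filter fun j => ancestor n A (f j) = Q).card : ℝ) := by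
    rw [← Finset.card_univ]
    exact_mod_cast Finset.card_eq_sum_card_image (fun j => ancestor n A (f j)) Finset.univ
  rw [hsum, Finset.mul_sum, mul_comm, ← nsmul_eq_mul]
  refine Finset.card_nsmul_le_sum _ _ _ fun Q hQ => ?_
  have := huni (ancestor n A (f i)) (by rw [hcov]; exact hmem i) Q (by rw [hcov]; exact hQ)
  rwa [hcc, hcc] at this

/-- Few points lie near a tube at the scale of the cells. -/
theorem card_near_le_thickCount_mul [Fintype ι] {n A : ℕ} (hA : A ≤ n) {f : ι → ℤ × ℤ} {B : ℝ}
    (hB : ∀ i, ((Finset.univ.filter fun j => ancestor n A (f j) = ancestor n A (f i)).card : ℝ) ≤ B)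
    {t : ℤ × ℤ} (hs : |(t.1 : ℝ) * scale n| ≤ 2) :
    ((Finset.univ.filter fun q => lineDist (cornerX n f) (cornerY n f) (t.1 * scale n)
      (t.2 * scale n) q ≤ 5 / 4 * scale A).card : ℝ) ≤
      thickCount n A (Finset.univ.val.map f) t * B := by
  classical
  set H := Finset.univ.filter fun q => lineDist (cornerX n f) (cornerY n f) (t.1 * scale n)
      (t.2 * scale n) q ≤ 5 / 4 * scale A with hH
  rcases H.eq_empty_or_nonempty with h0 | ⟨i₀, -⟩
  · rw [h0]
    simp only [Finset.card_empty, Nat.cast_zero]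
    rcases isEmpty_or_nonempty ι with h | ⟨⟨i⟩⟩
    · have : thickCount n A (Finset.univ.val.map f) t = 0 := by
        unfold thickCount
        rw [coverCubes_map hA]
        simp
      rw [this]; simp
    · exact mul_nonneg (Nat.cast_nonneg _) ((Nat.cast_nonneg _).trans (hB i))
  have hB0 : 0 ≤ B := (Nat.cast_nonneg _).trans (hB i₀)
  have h1 : (H.card : ℝ) ≤ (H.image fun i => ancestor n A (f i)).card * B := by
    rw [Finset.card_eq_sum_card_image (fun i => ancestor n A (f i)) H]
    push_cast
    rw [← nsmul_eq_mul]
    refine Finset.sum_le_card_nsmul _ _ _ fun Q hQ => ?_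
    obtain ⟨i, hi, rfl⟩ := Finset.mem_image.1 hQ
    refine le_trans ?_ (hB i)
    exact_mod_cast Finset.card_le_card (Finset.filter_subset_filter _ (Finset.subset_univ _))
  refine h1.trans (mul_le_mul_of_nonneg_right ?_ hB0)
  have hfin : {Q ∈ coverCubes n A (Finset.univ.val.map f) |
      cube A Q ⊆ fatTube 6 A (ancestor n A t)}.Finite :=
    (coverCubes_finite hA _).subset fun Q hQ => hQ.1
  unfold thickCount
  rw [← Set.ncard_coe_finset]
  refine Nat.cast_le.2 (Set.ncard_le_ncard ?_ hfin)
  intro Q hQ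
  obtain ⟨i, hi, rfl⟩ := Finset.mem_image.1 (Finset.mem_coe.1 hQ)
  refine ⟨?_, cube_subset_fatTube_of_lineDist_le hA hs (Finset.mem_filter.1 hi).2⟩
  rw [coverCubes_map hA]
  exact Finset.mem_coe.2 (Finset.mem_image_of_mem _ (Finset.mem_univ i))

theorem scale_le_of_six {n A : ℕ} (h : A + 6 ≤ n) : 64 * scale n ≤ scale A := by
  have := scale_anti h
  rw [scale_succ, scale_succ, scale_succ, scale_succ, scale_succ, scale_succ] at this
  linarith

/-- A rich tube carries a set of points equidistributed over `N` of its rich cells. -/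
theorem exists_points_of_rich [Fintype ι] {n A b N : ℕ} (hAn : A + 6 ≤ n) {f : ι → ℤ × ℤ}
    (hf : ∀ i, cube n (f i) ⊆ unitSquare)
    (hsep : ∀ i j, ancestor n A (f i) ≠ ancestor n A (f j) →
      ∀ p ∈ cube A (ancestor n A (f i)), ∀ q ∈ cube A (ancestor n A (f j)), scale A ≤ dist p q)
    (hb : 1 ≤ b) {t : ℤ × ℤ} (ht : t ∈ tubeIndices n)
    (hN : N ≤ richCount n A b (Finset.univ.val.map f) t) :
    ∃ S : Finset ι,
      (∀ q ∈ S, lineDist (cornerX n f) (cornerY n f) (t.1 * scale n) (t.2 * scale n) q ≤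
        12 * scale n) ∧
      (∀ i ∈ S, ∀ j ∈ S, ancestor n A (f i) ≠ ancestor n A (f j) →
        scale (A + 3) ≤ |cornerX n f i - cornerX n f j|) ∧
      (S.image fun i => ancestor n A (f i)).card = N ∧
      ∀ z ∈ S.image fun i => ancestor n A (f i),
        (S.filter fun q => ancestor n A (f q) = z).card = b := by
  classical
  have hA : A ≤ n := by omega
  have h64 := scale_le_of_six hAn
  have hA1 := scale_le_one A
  have hfin : {Q ∈ coverCubes n A (Finset.univ.val.map f) |
      b ≤ cubeCount n (Finset.univ.val.map f) (fatTube 4 n t ∩ cube A Q)}.Finite :=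
    (coverCubes_finite hA _).subset fun Q hQ => hQ.1
  have hN' : N ≤ hfin.toFinset.card := by
    rw [← Set.ncard_eq_toFinset_card _ hfin]; exact hN
  obtain ⟨R, hR, hRcard⟩ := Finset.exists_subset_card_eq hN'
  set U : ℤ × ℤ → Finset ι := fun Q =>
    Finset.univ.filter fun i => cube n (f i) ⊆ fatTube 4 n t ∩ cube A Q with hU
  obtain ⟨S, hS1, hS2, hS3⟩ := exists_equidistributed_subset R U (fun i => ancestor n A (f i)) hb
    (fun Q _ i hi => by
      have := ((Finset.mem_filter.1 hi).2.trans Set.inter_subset_right)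
      exact ((cube_subset_iff hA _ _).1 this).symm)
    (fun Q hQ => by
      have := (hfin.mem_toFinset.1 (hR hQ)).2
      rw [cubeCount_map] at this
      convert this)
  have hline : ∀ q ∈ S, lineDist (cornerX n f) (cornerY n f) (t.1 * scale n) (t.2 * scale n) q ≤
        12 * scale n := by
    intro q hq
    have := ((Finset.mem_filter.1 (hS1 q hq).2).2.trans Set.inter_subset_left)
    exact lineDist_le_of_subset_fatTube (by linarith) (hf q) ht this
  refine ⟨S, hline, ?_, by rw [hS2, hRcard], hS3⟩
  intro i hi j hj hij
  have hs := slope_le_of_mem_tubeIndices ht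
  have h1 := horizontal_sep (scale_pos A) h64 (c := t.1 * scale n) (e := t.2 * scale n)
    (by linarith) (hline i hi) (hline j hj) (corner_sep hA hsep hij)
  rw [scale_succ, scale_succ, scale_succ]
  linarith

/-- A rich cell of a tube is contained in the thickened tube. -/
theorem richCount_le_thickCount [Fintype ι] {n A b : ℕ} (hAn : A + 6 ≤ n) {f : ι → ℤ × ℤ}
    (hf : ∀ i, cube n (f i) ⊆ unitSquare) (hb : 1 ≤ b) {t : ℤ × ℤ} (ht : t ∈ tubeIndices n) :
    richCount n A b (Finset.univ.val.map f) t ≤ thickCount n A (Finset.univ.val.map f) t := by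
  classical
  have hA : A ≤ n := by omega
  have h64 := scale_le_of_six hAn
  have hA1 := scale_le_one A
  unfold richCount thickCount
  refine Set.ncard_le_ncard ?_ ((coverCubes_finite hA _).subset fun Q hQ => hQ.1)
  rintro Q ⟨hQ1, hQ2⟩
  refine ⟨hQ1, ?_⟩
  rw [cubeCount_map] at hQ2
  obtain ⟨i, hi⟩ := Finset.card_pos.1 (lt_of_lt_of_le (by omega) hQ2)
  have hi := (Finset.mem_filter.1 hi).2
  have hQ := (cube_subset_iff hA _ _).1 (hi.trans Set.inter_subset_right)
  have h1 := lineDist_le_of_subset_fatTube (by linarith) (hf i) ht (hi.trans Set.inter_subset_left)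
  have hs := slope_le_of_mem_tubeIndices ht
  have := scale_pos n
  rw [hQ]
  exact cube_subset_fatTube_of_lineDist_le hA (by linarith) (by linarith)

/-- The tubes that pass near a point of the unit square. -/
theorem mem_box_of_lineDist_le {n : ℕ} {x y : ι → ℝ} {i : ι} (hx : 0 ≤ x i ∧ x i < 1)
    (hy : 0 ≤ y i ∧ y i < 1) (hn : scale n ≤ 1 / 64) {t : ℤ × ℤ} (ht : t ∈ tubeIndices n)
    (h : lineDist x y (t.1 * scale n) (t.2 * scale n) i ≤ 12 * scale n) :
    t ∈ Finset.Icc (-(2 * 2 ^ n) : ℤ) (2 * 2 ^ n) ×ˢ Finset.Icc (-(4 * 2 ^ n) : ℤ) (4 * 2 ^ n) := by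
  have hδ := scale_pos n
  have hs := slope_le_of_mem_tubeIndices ht
  have hinv : (2 : ℝ) ^ n * scale n = 1 := by unfold scale; field_simp
  have h1 := abs_le.1 hs
  have h2 := abs_le.1 h
  have h3 : |(t.1 : ℝ) * scale n * x i| ≤ 2 * 1 := by
    rw [abs_mul]
    refine mul_le_mul (by linarith) ?_ (abs_nonneg _) (by norm_num)
    rw [abs_of_nonneg hx.1]; exact hx.2.le
  have h4 := abs_le.1 h3
  have conv : ∀ (a : ℤ) (c : ℕ), |(a : ℝ) * scale n| ≤ c → -((c : ℤ) * 2 ^ n) ≤ a ∧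
      a ≤ (c : ℤ) * 2 ^ n := by
    intro a c hac
    have g := abs_le.1 hac
    constructor
    · have : (-((c : ℝ) * 2 ^ n)) * scale n ≤ a * scale n := by
        calc (-((c : ℝ) * 2 ^ n)) * scale n = -(c * (2 ^ n * scale n)) := by ring
          _ ≤ _ := by rw [hinv, mul_one]; exact g.1
      have := le_of_mul_le_mul_right this hδ
      exact_mod_cast this
    · have : (a : ℝ) * scale n ≤ ((c : ℝ) * 2 ^ n) * scale n := by
        calc (a : ℝ) * scale n ≤ c := g.2
          _ = c * (2 ^ n * scale n) := by rw [hinv, mul_one]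
          _ = _ := by ring
      have := le_of_mul_le_mul_right this hδ
      exact_mod_cast this
  have r1 := conv t.1 2 (by push_cast; linarith)
  have r2 := conv t.2 4 (by push_cast; rw [abs_le]; constructor <;> linarith)
  push_cast at r1 r2
  simp only [Finset.mem_product, Finset.mem_Icc]
  exact ⟨r1, r2⟩

theorem card_box (n : ℕ) :
    ((Finset.Icc (-(2 * 2 ^ n) : ℤ) (2 * 2 ^ n) ×ˢ
      Finset.Icc (-(4 * 2 ^ n) : ℤ) (4 * 2 ^ n)).card : ℝ) ≤ 45 * 4 ^ n := by
  rw [Finset.card_product, Int.card_Icc, Int.card_Icc]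
  have h1 : ((2 * 2 ^ n + 1 - -(2 * 2 ^ n) : ℤ)).toNat = 4 * 2 ^ n + 1 := by
    rw [show (2 * 2 ^ n + 1 - -(2 * 2 ^ n) : ℤ) = ((4 * 2 ^ n + 1 : ℕ) : ℤ) by push_cast; ring]
    exact Int.toNat_natCast _
  have h2 : ((4 * 2 ^ n + 1 - -(4 * 2 ^ n) : ℤ)).toNat = 8 * 2 ^ n + 1 := by
    rw [show (4 * 2 ^ n + 1 - -(4 * 2 ^ n) : ℤ) = ((8 * 2 ^ n + 1 : ℕ) : ℤ) by push_cast; ring]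
    exact Int.toNat_natCast _
  rw [h1, h2]
  push_cast
  have h3 : (1 : ℝ) ≤ 2 ^ n := one_le_pow₀ (by norm_num)
  have h4 : (4 : ℝ) ^ n = 2 ^ n * 2 ^ n := by rw [← mul_pow]; norm_num
  rw [h4]
  nlinarith

theorem card_cells_le [Fintype ι] {n A : ℕ} (hA : A ≤ n) {f : ι → ℤ × ℤ}
    (hf : ∀ i, cube n (f i) ⊆ unitSquare) (S : Finset ι) :
    ((S.image fun i => ancestor n A (f i)).card : ℝ) ≤ 4 ^ n := by
  have hsub : (S.image fun i => ancestor n A (f i)) ⊆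
      Finset.Ico (0 : ℤ) (2 ^ A) ×ˢ Finset.Ico (0 : ℤ) (2 ^ A) := by
    intro Q hQ
    obtain ⟨i, -, rfl⟩ := Finset.mem_image.1 hQ
    obtain ⟨⟨h1, h2⟩, h3, h4⟩ := corner_bounds hf i
    have hD := scale_pos A
    have hinv : (2 : ℝ) ^ A * scale A = 1 := by unfold scale; field_simp
    have key : ∀ v : ℝ, 0 ≤ v → v < 1 → 0 ≤ ⌊v / scale A⌋ ∧ ⌊v / scale A⌋ < 2 ^ A := by
      intro v h0 h1
      refine ⟨Int.floor_nonneg.2 (by positivity), ?_⟩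
      rw [Int.floor_lt]
      push_cast
      rw [div_lt_iff₀ hD, hinv]
      exact h1
    rw [ancestor_eq_floor hA]
    simp only [Finset.mem_product, Finset.mem_Ico]
    exact ⟨key _ h1 h2, key _ h3 h4⟩
  have := Finset.card_le_card hsub
  rw [Finset.card_product, Int.card_Ico, sub_zero] at this
  have e : ((2 : ℤ) ^ A).toNat = 2 ^ A := by
    rw [show (2 : ℤ) ^ A = ((2 ^ A : ℕ) : ℤ) by push_cast; rfl]
    exact Int.toNat_natCast _
  rw [e] at this
  have h1 : ((S.image fun i => ancestor n A (f i)).card : ℝ) ≤ 2 ^ A * 2 ^ A := by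
    exact_mod_cast this
  have h2 : (2 : ℝ) ^ A * 2 ^ A = 4 ^ A := by rw [← mul_pow]; norm_num
  rw [h2] at h1
  exact h1.trans (pow_le_pow_right₀ (by norm_num) hA)

/-! ### The estimate for rich tubes -/

/-- Powers of `log (1/δ)` are dominated by `δ^(-ε)`. -/
theorem exists_growth {m : ℕ} (hm : 1 ≤ m) (K : ℝ) :
    ∃ c : ℝ, 0 < c ∧ ∃ n₀ : ℕ, (∀ n : ℕ, (n : ℝ) ^ 8 ≤ c * scale n ^ (-(1 / (m : ℝ)))) ∧
      ∀ n : ℕ, n₀ ≤ n → 576 * n * K ≤ scale n ^ (-(1 / (m : ℝ))) := by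
  have hm0 : (0 : ℝ) < m := by exact_mod_cast hm
  set r : ℝ := 2 ^ (1 / (m : ℝ)) with hr
  have hr1 : 1 < r := Real.one_lt_rpow (by norm_num) (by positivity)
  have hE : ∀ n : ℕ, scale n ^ (-(1 / (m : ℝ))) = r ^ n := by
    intro n
    unfold scale
    rw [Real.inv_rpow (by positivity), Real.rpow_neg (by positivity), inv_inv, hr,
      ← Real.rpow_natCast, ← Real.rpow_natCast, ← Real.rpow_mul (by norm_num),
      ← Real.rpow_mul (by norm_num), mul_comm]
  simp_rw [hE]
  obtain ⟨c, hc⟩ := (tendsto_pow_const_div_const_pow_of_one_lt 8 hr1).bddAbove_range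
  have h1 := tendsto_pow_const_div_const_pow_of_one_lt 1 hr1
  have h2 : ∀ᶠ n : ℕ in Filter.atTop, (n : ℝ) ^ 1 / r ^ n < 1 / (576 * (|K| + 1)) :=
    h1.eventually_lt_const (by positivity)
  obtain ⟨n₀, hn₀⟩ := Filter.eventually_atTop.1 h2
  refine ⟨|c| + 1, by positivity, n₀, fun n => ?_, fun n hn => ?_⟩
  · have hrn : 0 < r ^ n := by positivity
    have := hc ⟨n, rfl⟩
    simp only at this
    rw [div_le_iff₀ hrn] at this
    refine this.trans (mul_le_mul_of_nonneg_right ?_ hrn.le)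
    linarith [le_abs_self c]
  · have hrn : 0 < r ^ n := by positivity
    have := hn₀ n hn
    rw [pow_one, div_lt_div_iff₀ hrn (by positivity)] at this
    have h3 : (n : ℝ) * K ≤ n * (|K| + 1) :=
      mul_le_mul_of_nonneg_left (by linarith [le_abs_self K]) (Nat.cast_nonneg _)
    linarith

end RichTubes

open RichTubes
/-- Here `ε = 1/m`, `δ = 2⁻ⁿ = scale n`, `Δ = 2^(-m s) = scale (m * s)`, so that the intermediate
scales are `Δ^(k ε) = 2^(-k s) = scale (k * s)`, `1 ≤ k ≤ m`. -/
theorem mainTheorem6 (m : ℕ) (hm : 1 ≤ m) (K : ℝ) (hK : 1 ≤ K) :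
    ∃ C : ℝ, 0 < C ∧
      ∀ (s n : ℕ), scale n < scale (m * s) / 32 →
      ∀ P : Multiset (ℤ × ℤ),
        (∀ p ∈ P, cube n p ⊆ unitSquare) →
        -- uniformity
        (∀ k : ℕ, 1 ≤ k → k ≤ m →
          ∀ Q ∈ coverCubes n (k * s) P, ∀ Q' ∈ coverCubes n (k * s) P,
            (cubeCount n P (cube (k * s) Q) : ℝ) ≤ K * cubeCount n P (cube (k * s) Q')) →
        -- separation
        (∀ Q ∈ coverCubes n (m * s) P, ∀ Q' ∈ coverCubes n (m * s) P, Q ≠ Q' →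
          ∀ x ∈ cube (m * s) Q, ∀ y ∈ cube (m * s) Q', scale (m * s) ≤ dist x y) →
      ∀ (a : ℝ) (b : ℕ), 2 ≤ a →
        scale n ^ (1 - 2 * (1 / (m : ℝ))) * (Multiset.card P : ℝ) < a * b →
      ∀ 𝒯 : Set (ℤ × ℤ), 𝒯 ⊆ tubeIndices n →
        -- non-concentration at every intermediate scale
        (∀ t ∈ 𝒯, ∀ k : ℕ, 1 ≤ k → k ≤ m →
          (thickCount n (k * s) P t : ℝ) ≤
            scale (m * s) ^ (-(1 / (m : ℝ))) * scale (k * s) * (coverCubes n (k * s) P).ncard) →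
        -- richness
        (∀ t ∈ 𝒯, a ≤ (richCount n (m * s) b P t : ℝ)) →
        𝒯.Finite ∧
          (𝒯.ncard : ℝ) ≤
            C * ((Multiset.card P : ℝ) ^ 2 / (a ^ 3 * (b : ℝ) ^ 2)) *
              scale n ^ (-(5 * (1 / (m : ℝ)))) := by
  classical
  obtain ⟨c₀, hc₀, n₀, hpow, hlarge⟩ := exists_growth hm K
  set c₁ : ℝ := 72 * 102400000 * 19 * (144 * 288 * 4 + 401408) with hc₁
  have hK0 : 0 < K := by linarith
  refine ⟨c₁ * c₀ * K + 45 * 16 ^ n₀, by positivity, ?_⟩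
  intro s n hscale P hunit huni hsep a b ha hab 𝒯 h𝒯 hthick hrich
  obtain ⟨M, f, rfl⟩ := exists_eq_map_univ P
  set A := m * s with hAdef
  set ε : ℝ := 1 / (m : ℝ) with hε
  set E : ℝ := scale n ^ (-ε) with hEdef
  have hδ := scale_pos n
  have hD := scale_pos A
  have hm0 : (0 : ℝ) < m := by exact_mod_cast hm
  have hε0 : 0 < ε := by positivity
  have hE1 : 1 ≤ E := Real.one_le_rpow_of_pos_of_le_one_of_nonpos hδ (scale_le_one n) (by linarith)
  have hE2 : scale n ^ (1 - 2 * ε) = scale n * E ^ 2 := by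
    rw [hEdef, ← Real.rpow_natCast, ← Real.rpow_mul hδ.le, sub_eq_add_neg, Real.rpow_add hδ,
      Real.rpow_one]
    congr 2
    push_cast
    ring
  have hE5 : scale n ^ (-(5 * ε)) = E ^ 5 := by
    rw [hEdef, ← Real.rpow_natCast, ← Real.rpow_mul hδ.le]
    congr 1
    push_cast
    ring
  have hAn : A + 6 ≤ n := by
    by_contra hcon
    have h1 : scale (A + 5) ≤ scale n := scale_anti (by omega)
    rw [scale_succ, scale_succ, scale_succ, scale_succ, scale_succ] at h1
    linarith
  have hA : A ≤ n := by omega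
  have hGE : scale A ^ (-ε) ≤ E :=
    Real.rpow_le_rpow_of_nonpos hδ (scale_anti hA) (by linarith)
  have hn64 : scale n ≤ 1 / 64 := by
    linarith [scale_le_of_six hAn, scale_le_one A]
  rw [hE2] at hab
  rw [hE5]
  simp only [Multiset.card_map, Finset.card_val, Finset.card_univ, Fintype.card_fin] at hab ⊢
  have hf : ∀ i, cube n (f i) ⊆ unitSquare := fun i =>
    hunit _ (Multiset.mem_map_of_mem f (Finset.mem_univ_val i))
  have hmemc : ∀ i, ancestor n A (f i) ∈ coverCubes n A (Finset.univ.val.map f) := by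
    intro i
    rw [coverCubes_map hA]
    exact Finset.mem_coe.2 (Finset.mem_image_of_mem _ (Finset.mem_univ i))
  have hsep' : ∀ i j, ancestor n A (f i) ≠ ancestor n A (f j) →
      ∀ p ∈ cube A (ancestor n A (f i)), ∀ q ∈ cube A (ancestor n A (f j)), scale A ≤ dist p q :=
    fun i j hij => hsep _ (hmemc i) _ (hmemc j) hij
  have hb : 1 ≤ b := by
    by_contra hcon
    have : b = 0 := by omega
    rw [this] at hab
    have : 0 ≤ scale n * E ^ 2 * (M : ℝ) := by positivity
    simp at hab
    linarith
  have hb0 : (0 : ℝ) < b := by exact_mod_cast hb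
  set N := ⌈a⌉₊ with hN
  have haN : a ≤ N := Nat.le_ceil a
  have hN2 : 2 ≤ N := by
    have : (2 : ℝ) ≤ N := ha.trans haN
    exact_mod_cast this
  have ha0 : 0 < a := by linarith
  have hNrich : ∀ t ∈ 𝒯, N ≤ richCount n A b (Finset.univ.val.map f) t := fun t ht =>
    Nat.ceil_le.2 (hrich t ht)
  have hpts := fun t ht => exists_points_of_rich hAn hf hsep' hb (h𝒯 ht) (hNrich t ht)
  have hbox : 𝒯 ⊆ ((Finset.Icc (-(2 * 2 ^ n) : ℤ) (2 * 2 ^ n) ×ˢ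
      Finset.Icc (-(4 * 2 ^ n) : ℤ) (4 * 2 ^ n) : Finset (ℤ × ℤ)) : Set (ℤ × ℤ)) := by
    intro t ht
    obtain ⟨S, hS1, -, hS3, -⟩ := hpts t ht
    have hne : S.Nonempty := by
      rw [Finset.nonempty_iff_ne_empty]
      rintro rfl
      simp at hS3
      omega
    obtain ⟨i, hi⟩ := hne
    exact Finset.mem_coe.2 (mem_box_of_lineDist_le (corner_bounds hf i).1 (corner_bounds hf i).2
      hn64 (h𝒯 ht) (hS1 i hi))
  have hfin : 𝒯.Finite := (Finset.finite_toSet _).subset hbox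
  refine ⟨hfin, ?_⟩
  lift 𝒯 to Finset (ℤ × ℤ) using hfin
  rw [Set.ncard_coe_finset]
  rcases 𝒯.eq_empty_or_nonempty with rfl | ⟨t₀, ht₀⟩
  · simp only [Finset.card_empty, Nat.cast_zero]; positivity
  obtain ⟨S₀, -, -, hS₀3, hS₀4⟩ := hpts t₀ (Finset.mem_coe.2 ht₀)
  have hNbM : N * b ≤ M := by
    rw [← (half_le_card_pairs S₀ _ hN2 hS₀3 hS₀4).1]
    simpa using Finset.card_le_univ S₀
  have habM : a * b ≤ M := by
    have : (N : ℝ) * b ≤ M := by exact_mod_cast hNbM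
    exact (mul_le_mul_of_nonneg_right haN hb0.le).trans this
  have hM0 : (0 : ℝ) < M := lt_of_lt_of_le (by positivity) habM
  set W := (M : ℝ) ^ 2 / (a ^ 3 * (b : ℝ) ^ 2) with hW
  have hW0 : 0 ≤ W := by positivity
  have hE5' : 1 ≤ E ^ 5 := one_le_pow₀ hE1
  by_cases hn : n < n₀
  · -- for large `δ` the trivial bounds suffice
    have h1 : (𝒯.card : ℝ) ≤ 45 * 4 ^ n :=
      le_trans (by exact_mod_cast Finset.card_le_card (Finset.coe_subset.1 hbox)) (card_box n)
    have h2 : a ≤ 4 ^ n := by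
      have := card_cells_le hA hf S₀
      rw [hS₀3] at this
      exact haN.trans this
    have h3 : 1 ≤ a * W := by
      have e : a * W = (M : ℝ) ^ 2 / (a * b) ^ 2 := by
        rw [hW]; field_simp
      rw [e, one_le_div (by positivity)]
      exact pow_le_pow_left₀ (by positivity) habM 2
    have h4 : (1 : ℝ) ≤ 4 ^ n * W := h3.trans (mul_le_mul_of_nonneg_right h2 hW0)
    have h5 : (16 : ℝ) ^ n ≤ 16 ^ n₀ := pow_le_pow_right₀ (by norm_num) hn.le
    have h6 : (16 : ℝ) ^ n = 4 ^ n * 4 ^ n := by rw [← mul_pow]; norm_num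
    calc (𝒯.card : ℝ) ≤ 45 * 4 ^ n * (4 ^ n * W) := h1.trans (le_mul_of_one_le_right
            (by positivity) h4)
      _ = 45 * 16 ^ n * W := by rw [h6]; ring
      _ ≤ (c₁ * c₀ * K + 45 * 16 ^ n₀) * W := by
          refine mul_le_mul_of_nonneg_right ?_ hW0
          have : 0 ≤ c₁ * c₀ * K := by positivity
          linarith
      _ ≤ _ := le_mul_of_one_le_right (by positivity) hE5'
  · have hEn := hlarge n (le_of_not_gt hn)
    set X := (coverCubes n A (Finset.univ.val.map f)).ncard with hX
    have hthickA : ∀ t ∈ 𝒯, (thickCount n A (Finset.univ.val.map f) t : ℝ) ≤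
        E * scale A * X := by
      intro t ht
      refine (hthick t (Finset.mem_coe.2 ht) m hm le_rfl).trans ?_
      gcongr
    have haX : a ≤ E * scale A * X := by
      refine (hrich t₀ (Finset.mem_coe.2 ht₀)).trans (le_trans ?_ (hthickA t₀ ht₀))
      exact_mod_cast richCount_le_thickCount hAn hf hb (h𝒯 (Finset.mem_coe.2 ht₀))
    have hX0 : (0 : ℝ) < X := by
      by_contra hcon
      have : (X : ℝ) = 0 := le_antisymm (le_of_not_gt hcon) (Nat.cast_nonneg _)
      rw [this, mul_zero] at haX
      linarith
    have hB := card_cell_le hA (huni m hm le_rfl)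
    rw [Fintype.card_fin] at hB
    set B := K * (M : ℝ) / X with hBdef
    -- four times the density that non-concentration allows at the scale of the cells
    set Λ := 4 * K * E * M with hΛ
    have hΛ0 : 0 < Λ := by positivity
    have hslope : ∀ t ∈ 𝒯, |(t.1 : ℝ) * scale n| ≤ 2 := fun t ht =>
      (slope_le_of_mem_tubeIndices (h𝒯 (Finset.mem_coe.2 ht))).trans (by linarith)
    have hlow : ∀ t ∈ 𝒯, ((Finset.univ.filter fun q => lineDist (cornerX n f) (cornerY n f)
        (t.1 * scale n) (t.2 * scale n) q ≤ 5 / 4 * scale A).card : ℝ) ≤ Λ * scale A / 4 := by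
      intro t ht
      refine (card_near_le_thickCount_mul hA hB (hslope t ht)).trans ?_
      refine (mul_le_mul_of_nonneg_right (hthickA t ht) (by positivity)).trans (le_of_eq ?_)
      rw [hBdef, hΛ]
      field_simp
    have hrich' : 144 * n * (scale n * Λ) < N * b := by
      have h1 : 144 * n * (scale n * Λ) = (scale n * M * E) * (576 * n * K) := by
        rw [hΛ]; ring
      have h2 : (scale n * M * E) * (576 * n * K) ≤ (scale n * M * E) * E :=
        mul_le_mul_of_nonneg_left hEn (by positivity)
      have h3 : a * b ≤ N * b := mul_le_mul_of_nonneg_right haN hb0.le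
      calc 144 * n * (scale n * Λ) ≤ scale n * E ^ 2 * M := by rw [h1]; linarith
        _ < a * b := hab
        _ ≤ _ := h3
    have hmain := card_rich_lines_mul_le hAn (fun i => (corner_bounds hf i).1)
      (fun i => (corner_bounds hf i).2) hΛ0 ha0 hN2 haN (fun i => ancestor n A (f i))
      (ancestor_eq_floor hA f) (by positivity) hB
      (fun i j hij => half_scale_le_supDist (corner_sep hA hsep' hij)) hrich' 𝒯 hslope hlow
      (fun t ht => hpts t (Finset.mem_coe.2 ht))
    rw [Fintype.card_fin] at hmain
    have hBD : B / scale A ≤ n ^ 3 * (K * E * M / a) := by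
      have h1 : B / scale A ≤ K * E * M / a := by
        rw [hBdef, div_div, div_le_div_iff₀ (by positivity) ha0]
        have := mul_le_mul_of_nonneg_left haX (show 0 ≤ K * (M : ℝ) by positivity)
        linarith
      have h2 : (1 : ℝ) ≤ n ^ 3 := one_le_pow₀ (by exact_mod_cast (by omega : 1 ≤ n))
      exact h1.trans (le_mul_of_one_le_left (by positivity) h2)
    have hle : (𝒯.card : ℝ) * (a * b) ^ 2 ≤ c₁ * n ^ 8 * K * E * M ^ 2 / a := by
      calc (𝒯.card : ℝ) * (a * b) ^ 2 ≤ 𝒯.card * ((N : ℝ) * b) ^ 2 := by gcongr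
        _ ≤ _ := hmain
        _ ≤ 72 * n ^ 5 * (102400000 * (19 * M) * (144 * (288 * n ^ 3 * Λ / a) +
            401408 * (n ^ 3 * (K * E * M / a)))) := by gcongr
        _ = _ := by rw [hΛ, hc₁]; field_simp
    have hfinal : (𝒯.card : ℝ) ≤ c₁ * n ^ 8 * K * E * W := by
      have e : c₁ * n ^ 8 * K * E * W = c₁ * n ^ 8 * K * E * M ^ 2 / a / (a * b) ^ 2 := by
        rw [hW]; field_simp
      rw [e, le_div_iff₀ (by positivity)]
      exact hle
    calc (𝒯.card : ℝ) ≤ c₁ * n ^ 8 * K * E * W := hfinal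
      _ ≤ c₁ * (c₀ * E) * K * E * W := by
          have := hpow n
          gcongr
      _ = c₁ * c₀ * K * W * E ^ 2 := by ring
      _ ≤ c₁ * c₀ * K * W * E ^ 5 := by
          refine mul_le_mul_of_nonneg_left (pow_le_pow_right₀ hE1 (by norm_num)) (by positivity)
      _ ≤ (c₁ * c₀ * K + 45 * 16 ^ n₀) * W * E ^ 5 := by
          have : c₁ * c₀ * K ≤ c₁ * c₀ * K + 45 * 16 ^ n₀ := by
            have : (0 : ℝ) < 45 * 16 ^ n₀ := by positivity
            linarith
          gcongr
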